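/- Let $n\ge 2$. On $so(k)$ (skew-symmetric real $k\times k$ matrices) use the inner product $\langle X,Y\rangle=\tfrac12\operatorname{tr}(X^{T}Y)$, with $|X|^2=\langle X,X\rangle$. Regard $SO(n-1)$ as the stabilizer of $e_n$ in $SO(n)$. *The Dirac monopole.* Let $C_0=\{f=rg : r>0,\ g\in SO(n)\}$ be the space of oriented orthogonal frames $f=(f_1,\dots,f_n)$ of $\mathbb R^n$ with $|f_1|=\dots=|f_n|>0$, written as matrices with columns $f_i$. It is a principal $SO(n-1)$-bundle over $\mathbb R^n\setminus\{0\}$ with projection $f\mapsto f_n$. Its connection form $A$ is the $so(n-1)$-valued one-form whose value $A_f(v)$ on a tangent vector $v$ at $f$ is the upper left $(n-1)\times(n-1)$ block of the skew-symmetric part of $f^{-1}v$ (that is, the $so(n-1)$-block of $g^{-1}\dot g$). Let $\mathrm{Ad}(C_0)=C_0\times_{SO(n-1)}so(n-1)\to\mathbb R^n\setminus\{0\}$ be the adjoint bundle, with elements $[f,X]=[fh,h^{-1}Xh]$, $h\in SO(n-1)$, with the induced fibre inner product and the induced covariant derivative $D$: if $\phi=[f,X]$, then $D\phi/dt=[f,\dot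 X+[A_f(\dot f),X]]$. The curvature $F$ is the $\mathrm{Ad}(C_0)$-valued two-form $F(x,y)=[f,A_f([x^h,y^h])]$, where $x^h,y^h$ are horizontal lifts; equivalently $F=-(dA+\tfrac12[A\wedge A])$ on horizontal lifts. *The generalized MICZ-Kepler system.* Let $I\subseteq\mathbb R$ be an open interval and $t_0\in I$. A solution on $I$ is a pair $(q,\phi)$, where $q$ is a curve in $\mathbb R^n\setminus\{0\}$ and $\phi(t)$ lies in the fibre of $\mathrm{Ad}(C_0)$ over $q(t)$, such that on $I$, with $r=|q|$, $$\ddot q=-\frac{q}{r^3}+\frac{|\phi|^2q}{r^4}+\phi\cdot F(\dot q,\cdot),\qquad \frac{D\phi}{dt}=0,$$ where $\phi\cdot F(\dot q,\cdot)$ is the vector whose $j$-th coordinate is $\langle\phi,F(\dot q,e_j)\rangle$. *Claim.* (1) For every solution $(q,\phi)$ on $I$ there are $\xi\in so(n)$, $w\in S^{n-1}$, a function $r:I\to(0,\infty)$ with $\ddot r=-V'(r)$, where $V(r)=-\frac1r+\frac{|\xi|^2}{2r^2}$, and a function $u:I\to\mathbb R$ with $\dot u=1/r^2$, such that $$q(t)=r(t)\exp(u(t)\xi)\,w\qquad(t\in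 I),$$ and, for every $f_0\in C_0$ projecting to $q(t_0)$, $\phi$ is the parallel transport along $q$ of the vector $\phi(t_0)=[f_0,A_{f_0}(\xi)]$. Here $A_f(\xi)$ is the value of $A$ at $f$ on the infinitesimal generator $\xi f$ of the left action of $\exp(t\xi)$, and parallel transport of $[f_0,X]$ along $q$ means $\phi(t)=[f(t),X]$ for the horizontal lift $f$ of $q$ with $f(t_0)=f_0$. (2) Conversely, let $\xi\in so(n)$, $w\in S^{n-1}$, and $r$, $u$ be as in (1), put $q(t)=r(t)\exp(u(t)\xi)w$ on $I$, and let $f_0\in C_0$ project to $q(t_0)$. Then the parallel transport $\phi$ of $[f_0,A_{f_0}(\xi)]$ along $q$ exists on $I$, and $(q,\phi)$ is a solution on $I$. -/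

import Mathlib

open scoped Matrix

noncomputable section

namespace MICZ

attribute [local instance 100] LieRing.ofAssociativeRing

/-- Real square matrices of size `k`. -/
abbrev Mat (k : ℕ) : Type := Matrix (Fin k) (Fin k) ℝ

/-- Euclidean space `ℝⁿ` with `n = m + 1`. -/
abbrev Vec (m : ℕ) : Type := EuclideanSpace ℝ (Fin (m + 1))

/-- The rotation group `SO(k)`. -/
abbrev SO (k : ℕ) : Submonoid (Mat k) := Matrix.specialOrthogonalGroup (Fin k) ℝ

/-- The Lie algebra `so(k)` of skew-symmetric matrices. -/
abbrev so (k : ℕ) : LieSubalgebra ℝ (Mat k) := LieAlgebra.Orthogonal.so (Fin k) ℝ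

/-- The bi-invariant inner product `⟨X, Y⟩ = ½ tr (Xᵀ Y) = ∑_{i<j} X_ij Y_ij` on `so(k)`: the multiple
of the Killing form for which the elements `e_i ∧ e_j`, `i < j`, are orthonormal. -/
def soInner {k : ℕ} (X Y : so k) : ℝ := (1 / 2) * ((X : Mat k)ᵀ * (Y : Mat k)).trace

/-- `|X|²` for `X ∈ so(k)`. -/
def soNormSq {k : ℕ} (X : so k) : ℝ := soInner X X

/-- The last standard basis vector `e_n` of `ℝⁿ`, `n = m + 1`. -/
def eLast (m : ℕ) : Fin (m + 1) → ℝ := Pi.single (Fin.last m) 1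

/-- The inclusion `SO(n-1) ⊂ SO(n)` as the stabilizer of `e_n`: `h ↦ diag(h, 1)`. -/
def embed {m : ℕ} (h : Mat m) : Mat (m + 1) :=
  Matrix.reindex finSumFinEquiv finSumFinEquiv
    (Matrix.fromBlocks h 0 0 (1 : Matrix (Fin 1) (Fin 1) ℝ))

theorem embed_mul {m : ℕ} (h k : Mat m) : embed (h * k) = embed h * embed k := by
  simp [embed, Matrix.fromBlocks_multiply, Matrix.submatrix_mul_equiv]

theorem embed_one {m : ℕ} : embed (1 : Mat m) = 1 := by
  simp [embed, Matrix.fromBlocks_one]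

theorem embed_transpose {m : ℕ} (h : Mat m) : embed hᵀ = (embed h)ᵀ := by
  simp [embed, Matrix.fromBlocks_transpose]

theorem embed_det {m : ℕ} (h : Mat m) : (embed h).det = h.det := by
  simp [embed]

theorem embed_mulVec_eLast {m : ℕ} (h : Mat m) : embed h *ᵥ eLast m = eLast m := by
  ext i
  refine Fin.lastCases ?_ (fun i => ?_) i
  · simp [embed, eLast, finSumFinEquiv_symm_last]
  · simp [embed, eLast, finSumFinEquiv_symm_last]

theorem SO.transpose_mul {k : ℕ} {h : Mat k} (hh : h ∈ SO k) : hᵀ * h = 1 := by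
  have := (Matrix.mem_specialOrthogonalGroup_iff.1 hh).1
  simpa [Matrix.star_eq_conjTranspose] using (Matrix.mem_orthogonalGroup_iff' (Fin k) ℝ).1 this

theorem SO.mul_transpose {k : ℕ} {h : Mat k} (hh : h ∈ SO k) : h * hᵀ = 1 := by
  have := (Matrix.mem_specialOrthogonalGroup_iff.1 hh).1
  simpa [Matrix.star_eq_conjTranspose] using (Matrix.mem_orthogonalGroup_iff (Fin k) ℝ).1 this

theorem SO.det_eq {k : ℕ} {h : Mat k} (hh : h ∈ SO k) : h.det = 1 :=
  (Matrix.mem_specialOrthogonalGroup_iff.1 hh).2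

theorem SO.transpose_mem {k : ℕ} {h : Mat k} (hh : h ∈ SO k) : hᵀ ∈ SO k := by
  refine Matrix.mem_specialOrthogonalGroup_iff.2
    ⟨(Matrix.mem_orthogonalGroup_iff (Fin k) ℝ).2 ?_, by rw [Matrix.det_transpose, SO.det_eq hh]⟩
  simpa [Matrix.star_eq_conjTranspose] using SO.transpose_mul hh

/-- The total space `C₀` of the Dirac monopole: oriented orthogonal frames `f = (f_1, …, f_n)` of `ℝⁿ`
whose members have a common length `r > 0`. The vectors `f_i` are the columns of the matrix `mat`,
so `mat = r g` with `g ∈ SO(n)`. -/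
@[ext] structure Frame (m : ℕ) where
  mat : Mat (m + 1)
  conformal : ∃ r : ℝ, 0 < r ∧ matᵀ * mat = r ^ 2 • (1 : Mat (m + 1))
  det_pos : 0 < mat.det

/-- The bundle projection `C₀ → ℝⁿ ∖ {0}`, `f ↦ f_n`. -/
def Frame.proj {m : ℕ} (f : Frame m) : Vec m := WithLp.toLp 2 (fun i => f.mat i (Fin.last m))

theorem Frame.proj_eq {m : ℕ} (f : Frame m) : f.proj = WithLp.toLp 2 (f.mat *ᵥ eLast m) := by
  ext i
  simp [Frame.proj, eLast]

/-- The right action of `SO(n-1)` on `C₀`. -/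
def Frame.act {m : ℕ} (f : Frame m) (h : Mat m) (hh : h ∈ SO m) : Frame m where
  mat := f.mat * embed h
  conformal := by
    obtain ⟨r, hr, hf⟩ := f.conformal
    refine ⟨r, hr, ?_⟩
    have h1 : (embed h)ᵀ * embed h = 1 := by
      rw [← embed_transpose, ← embed_mul, SO.transpose_mul hh, embed_one]
    calc (f.mat * embed h)ᵀ * (f.mat * embed h)
        = (embed h)ᵀ * (f.matᵀ * f.mat) * embed h := by
          rw [Matrix.transpose_mul]; simp only [Matrix.mul_assoc]
      _ = r ^ 2 • (1 : Mat (m + 1)) := by rw [hf]; simp [h1]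
  det_pos := by
    rw [Matrix.det_mul, embed_det, SO.det_eq hh, mul_one]
    exact f.det_pos

/-- `Ad_{h⁻¹} X = h⁻¹ X h` for `h ∈ SO(k)` and `X ∈ so(k)`; here `h⁻¹ = hᵀ`. -/
def adInv {k : ℕ} (h : Mat k) (X : so k) : so k :=
  ⟨hᵀ * (X : Mat k) * h, by
    have hX := (LieAlgebra.Orthogonal.mem_so (Fin k) ℝ (X : Mat k)).1 X.2
    rw [LieAlgebra.Orthogonal.mem_so]
    simp [Matrix.transpose_mul, hX, Matrix.mul_assoc]⟩

/-- The relation `(f, X) ∼ (f h, Ad_{h⁻¹} X)`, `h ∈ SO(n-1)`, on `C₀ × so(n-1)`. -/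
def adSetoid (m : ℕ) : Setoid (Frame m × so m) where
  r p p' := ∃ (h : Mat m) (hh : h ∈ SO m), p' = (p.1.act h hh, adInv h p.2)
  iseqv :=
    { refl := fun p => ⟨1, Submonoid.one_mem _, by
        refine Prod.ext (Frame.ext ?_) (Subtype.ext ?_)
        · simp [Frame.act, embed_one]
        · simp [adInv]⟩
      symm := by
        rintro p _ ⟨h, hh, rfl⟩
        refine ⟨hᵀ, SO.transpose_mem hh, ?_⟩
        refine Prod.ext (Frame.ext ?_) (Subtype.ext ?_)
        · simp [Frame.act, Matrix.mul_assoc, ← embed_mul, SO.mul_transpose hh, embed_one]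
        · have := SO.mul_transpose hh
          simp only [adInv, Matrix.transpose_transpose]
          calc (p.2 : Mat m) = (h * hᵀ) * p.2 * (h * hᵀ) := by simp [this]
            _ = _ := by simp only [Matrix.mul_assoc]
      trans := by
        rintro p _ _ ⟨h, hh, rfl⟩ ⟨k, hk, rfl⟩
        refine ⟨h * k, Submonoid.mul_mem _ hh hk, ?_⟩
        refine Prod.ext (Frame.ext ?_) (Subtype.ext ?_)
        · simp [Frame.act, Matrix.mul_assoc, embed_mul]
        · simp [adInv, Matrix.mul_assoc] }

/-- The adjoint bundle `Ad(C₀) = C₀ ×_{SO(n-1)} so(n-1)` over `ℝⁿ ∖ {0}`. -/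
def AdBundle (m : ℕ) : Type := Quotient (adSetoid m)

/-- The class `[f, X]` in the adjoint bundle. -/
def AdBundle.mk {m : ℕ} (f : Frame m) (X : so m) : AdBundle m := Quotient.mk (adSetoid m) (f, X)

/-- The projection `Ad(C₀) → ℝⁿ ∖ {0}`, `[f, X] ↦ f_n`. -/
def AdBundle.proj {m : ℕ} (φ : AdBundle m) : Vec m :=
  Quotient.lift (fun p : Frame m × so m => p.1.proj) (by
    rintro p _ ⟨h, hh, rfl⟩
    simp [Frame.proj_eq, Frame.act, ← Matrix.mulVec_mulVec, embed_mulVec_eLast]) φ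

/-- The elements of the zero section of the adjoint bundle. -/
def AdBundle.IsZero {m : ℕ} (φ : AdBundle m) : Prop := ∃ f : Frame m, φ = AdBundle.mk f 0

theorem soInner_adInv {k : ℕ} {h : Mat k} (hh : h ∈ SO k) (X Y : so k) :
    soInner (adInv h X) (adInv h Y) = soInner X Y := by
  have h1 := SO.mul_transpose hh
  simp only [soInner, adInv]
  congr 1
  calc ((hᵀ * (X : Mat k) * h)ᵀ * (hᵀ * (Y : Mat k) * h)).trace
      = (hᵀ * ((X : Mat k)ᵀ * (h * hᵀ) * (Y : Mat k) * h)).trace := by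
        simp [Matrix.transpose_mul, Matrix.mul_assoc]
    _ = ((X : Mat k)ᵀ * (h * hᵀ) * (Y : Mat k) * (h * hᵀ)).trace := by
        rw [Matrix.trace_mul_comm]; simp only [Matrix.mul_assoc]
    _ = _ := by simp [h1]

/-- The fibre norm: `|[f, X]|² = |X|²`. -/
def AdBundle.normSq {m : ℕ} (φ : AdBundle m) : ℝ :=
  Quotient.lift (fun p : Frame m × so m => soNormSq p.2) (by
    rintro p _ ⟨h, hh, rfl⟩
    exact (soInner_adInv hh p.2 p.2).symm) φ

/-! ### The Dirac monopole connection -/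

/-- The left-invariant `so(n)`-valued one-form on `C₀ ≅ ℝ⁺ × SO(n)`, pulled back from `SO(n)`. A tangent
vector of `C₀` at `f = r g` is `v = r' g + r g'`, so `f⁻¹ v = (r'/r) 1 + g⁻¹ g'`, and the
skew-symmetric part is `g⁻¹ g'`. The formula extends the form to all invertible `f` and all `v`. -/
def theta {m : ℕ} (f v : Mat (m + 1)) : Mat (m + 1) :=
  (1 / 2 : ℝ) • (f⁻¹ * v - (f⁻¹ * v)ᵀ)

/-- The monopole connection form `A = ∑_{i<j<n} θ_ij e_i ∧ e_j`: the `so(n-1)`-block of `theta`. -/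
def connForm {m : ℕ} (f v : Mat (m + 1)) : so m :=
  ⟨(theta f v).submatrix Fin.castSucc Fin.castSucc, by
    rw [LieAlgebra.Orthogonal.mem_so]
    ext i j
    simp only [theta, Matrix.transpose_apply, Matrix.submatrix_apply, Matrix.smul_apply,
      Matrix.sub_apply, Matrix.neg_apply, smul_eq_mul]
    ring⟩

/-- The exterior derivative `dA_f(v, w) = D_v (A(w)) - D_w (A(v))`, for constant `v`, `w`. -/
def dConnForm {m : ℕ} (f v w : Mat (m + 1)) : Mat m :=
  deriv (fun s : ℝ => (connForm (f + s • v) w : Mat m)) 0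
    - deriv (fun s : ℝ => (connForm (f + s • w) v : Mat m)) 0

/-- The two-form `dA + ½ [A ∧ A]` (Cartan's structure equation) on tangent vectors of `C₀`. -/
def structureForm {m : ℕ} (f v w : Mat (m + 1)) : Mat m :=
  dConnForm f v w + ⁅(connForm f v : Mat m), (connForm f w : Mat m)⁆

/-- The horizontal lift of `x ∈ ℝⁿ` to the tangent space of `C₀` at `f`; its characteristic properties
are `connForm_horizontalLift`, `horizontalLift_mulVec_eLast` and `horizontalLift_tangent`. -/
def horizontalLift {m : ℕ} (f : Frame m) (x : Vec m) : Mat (m + 1) :=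
  let y : Fin (m + 1) → ℝ := f.mat⁻¹ *ᵥ x.ofLp
  f.mat * (y (Fin.last m) • (1 : Mat (m + 1))
    + (Matrix.vecMulVec y (eLast m) - Matrix.vecMulVec (eLast m) y))

theorem Frame.isUnit_det {m : ℕ} (f : Frame m) : IsUnit f.mat.det :=
  isUnit_iff_ne_zero.2 f.det_pos.ne'

theorem connForm_horizontalLift {m : ℕ} (f : Frame m) (x : Vec m) :
    connForm f.mat (horizontalLift f x) = 0 := by
  apply Subtype.ext
  simp only [connForm, theta, horizontalLift, Matrix.nonsing_inv_mul_cancel_left _ _ f.isUnit_det]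
  ext i j
  simp [Matrix.vecMulVec_apply, eLast]

theorem horizontalLift_mulVec_eLast {m : ℕ} (f : Frame m) (x : Vec m) :
    WithLp.toLp 2 (horizontalLift f x *ᵥ eLast m) = x := by
  have h1 : f.mat *ᵥ (f.mat⁻¹ *ᵥ x.ofLp) = x.ofLp := by
    rw [Matrix.mulVec_mulVec, Matrix.mul_nonsing_inv _ f.isUnit_det, Matrix.one_mulVec]
  have h2 : horizontalLift f x *ᵥ eLast m = x.ofLp := by
    rw [← h1]
    simp only [horizontalLift, ← Matrix.mulVec_mulVec]
    congr 1
    ext i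
    simp [Matrix.vecMulVec_apply, eLast, Pi.single_apply, Matrix.one_apply]
  rw [h2]

/-- The tangent space of `C₀` at `f` is `f (ℝ 1 + so(n))`. -/
theorem horizontalLift_tangent {m : ℕ} (f : Frame m) (x : Vec m) :
    ∃ (ρ : ℝ) (a : so (m + 1)), horizontalLift f x = f.mat * (ρ • (1 : Mat (m + 1)) + a) := by
  refine ⟨(f.mat⁻¹ *ᵥ x.ofLp) (Fin.last m), ⟨Matrix.vecMulVec (f.mat⁻¹ *ᵥ x.ofLp) (eLast m)
    - Matrix.vecMulVec (eLast m) (f.mat⁻¹ *ᵥ x.ofLp), ?_⟩, rfl⟩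
  rw [LieAlgebra.Orthogonal.mem_so]
  simp [Matrix.transpose_vecMulVec]

theorem hasDerivAt_connForm {m : ℕ} {f : Mat (m + 1)} (hf : IsUnit f.det) (v w : Mat (m + 1)) :
    HasDerivAt (fun s : ℝ => (connForm (f + s • v) w : Mat m))
      ((theta 1 (-(f⁻¹ * v * (f⁻¹ * w)))).submatrix Fin.castSucc Fin.castSucc) 0 := by
  have key : HasDerivAt (fun s : ℝ => (f + s • v)⁻¹) (-(f⁻¹ * v * f⁻¹)) 0 := by
    let _ : NormedRing (Mat (m + 1)) := Matrix.linftyOpNormedRing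
    let _ : NormedAlgebra ℝ (Mat (m + 1)) := Matrix.linftyOpNormedAlgebra
    obtain ⟨u, hu⟩ := (Matrix.isUnit_iff_isUnit_det f).2 hf
    have h1 : HasDerivAt (fun s : ℝ => f + s • v) v 0 := by
      have h0 := ((hasDerivAt_id (0 : ℝ)).smul_const v).const_add f
      rw [one_smul] at h0
      exact h0
    have h2 := hasFDerivAt_ringInverse (𝕜 := ℝ) u
    have h3 : HasFDerivAt Ring.inverse
        (-ContinuousLinearMap.mulLeftRight ℝ (Mat (m + 1)) ↑u⁻¹ ↑u⁻¹) (f + (0 : ℝ) • v) := by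
      simpa [hu] using h2
    have h4 := h3.comp_hasDerivAt (0 : ℝ) h1
    have h5 : (↑u⁻¹ : Mat (m + 1)) = f⁻¹ := by rw [← hu, Matrix.coe_units_inv]
    have h6 : (-ContinuousLinearMap.mulLeftRight ℝ (Mat (m + 1)) ↑u⁻¹ ↑u⁻¹) v
        = -(f⁻¹ * v * f⁻¹) := by simp [h5]
    rw [h6] at h4
    simp only [Matrix.nonsing_inv_eq_ringInverse] at h4 ⊢
    exact h4
  have hij : ∀ i j, HasDerivAt (fun s : ℝ => ((f + s • v)⁻¹ * w) i j)
      ((-(f⁻¹ * v * (f⁻¹ * w))) i j) 0 := by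
    intro i j
    have e : -(f⁻¹ * v * (f⁻¹ * w)) = -(f⁻¹ * v * f⁻¹) * w := by
      simp [Matrix.mul_assoc]
    rw [e]
    simp only [Matrix.mul_apply (N := w)]
    refine HasDerivAt.fun_sum fun k _ => HasDerivAt.mul_const ?_ _
    exact hasDerivAt_pi.1 (hasDerivAt_pi.1 key i) k
  refine hasDerivAt_pi.2 fun i => hasDerivAt_pi.2 fun j => ?_
  have h7 := ((hij i.castSucc j.castSucc).sub (hij j.castSucc i.castSucc)).const_mul (1 / 2 : ℝ)
  simp only [theta, inv_one, one_mul]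
  exact h7

theorem dConnForm_eq {m : ℕ} {f : Mat (m + 1)} (hf : IsUnit f.det) (v w : Mat (m + 1)) :
    dConnForm f v w
      = (theta 1 (-(f⁻¹ * v * (f⁻¹ * w)))).submatrix Fin.castSucc Fin.castSucc
        - (theta 1 (-(f⁻¹ * w * (f⁻¹ * v)))).submatrix Fin.castSucc Fin.castSucc := by
  have key : ∀ (F : ℝ → Mat m) (F' : Mat m), HasDerivAt F F' 0 → deriv F 0 = F' := by
    intro F F' h
    let _ : NormedAddCommGroup (Mat m) := Matrix.normedAddCommGroup
    let _ : NormedSpace ℝ (Mat m) := Matrix.normedSpace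
    exact HasDerivAt.deriv (F := Mat m) h
  rw [dConnForm, key _ _ (hasDerivAt_connForm hf v w), key _ _ (hasDerivAt_connForm hf w v)]

theorem structureForm_mem {m : ℕ} {f : Mat (m + 1)} (hf : IsUnit f.det) (v w : Mat (m + 1)) :
    structureForm f v w ∈ so m := by
  rw [structureForm, dConnForm_eq hf]
  exact (so m).add_mem ((so m).sub_mem (connForm 1 _).2 (connForm 1 _).2)
    ((so m).lie_mem (connForm f v).2 (connForm f w).2)

/-- The `so(n-1)`-component, with respect to the frame `f`, of the curvature `F(x, y)` of the monopole
connection. Sign convention: `F(x, y) = A([x^h, y^h])` is the vertical part of the bracket of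
horizontal lifts, that is, minus the value of `dA + ½ [A ∧ A]` on the horizontal lifts. -/
def curvature {m : ℕ} (f : Frame m) (x y : Vec m) : so m :=
  ⟨-structureForm f.mat (horizontalLift f x) (horizontalLift f y),
    (so m).neg_mem (structureForm_mem f.isUnit_det _ _)⟩

theorem SO.embed_transpose_mul {m : ℕ} {h : Mat m} (hh : h ∈ SO m) :
    (embed h)ᵀ * embed h = 1 := by
  rw [← embed_transpose, ← embed_mul, SO.transpose_mul hh, embed_one]

theorem SO.embed_inv {m : ℕ} {h : Mat m} (hh : h ∈ SO m) : (embed h)⁻¹ = (embed h)ᵀ :=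
  Matrix.inv_eq_left_inv (SO.embed_transpose_mul hh)

theorem SO.embed_mul_transpose {m : ℕ} {h : Mat m} (hh : h ∈ SO m) :
    embed h * (embed h)ᵀ = 1 := by
  rw [← embed_transpose, ← embed_mul, SO.mul_transpose hh, embed_one]

theorem embed_castSucc {m : ℕ} (h : Mat m) (i j : Fin m) :
    embed h i.castSucc j.castSucc = h i j := by
  simp [embed]

theorem embed_last_castSucc {m : ℕ} (h : Mat m) (j : Fin m) :
    embed h (Fin.last m) j.castSucc = 0 := by
  simp [embed, finSumFinEquiv_symm_last]

theorem block_conj {m : ℕ} (h : Mat m) (M : Mat (m + 1)) :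
    ((embed h)ᵀ * M * embed h).submatrix Fin.castSucc Fin.castSucc
      = hᵀ * M.submatrix Fin.castSucc Fin.castSucc * h := by
  ext i j
  simp [Matrix.mul_apply, Fin.sum_univ_castSucc, embed_castSucc, embed_last_castSucc]

theorem theta_conj {m : ℕ} {h : Mat m} (M : Mat (m + 1)) :
    theta 1 ((embed h)ᵀ * M * embed h) = (embed h)ᵀ * theta 1 M * embed h := by
  simp [theta, Matrix.mul_sub, Matrix.sub_mul, Matrix.mul_assoc]

theorem inv_mul_conj {m : ℕ} {h : Mat m} (hh : h ∈ SO m) (f v : Mat (m + 1)) :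
    (f * embed h)⁻¹ * (v * embed h) = (embed h)ᵀ * (f⁻¹ * v) * embed h := by
  rw [Matrix.mul_inv_rev, SO.embed_inv hh]
  simp only [Matrix.mul_assoc]

theorem theta_eq {m : ℕ} (f v : Mat (m + 1)) : theta f v = theta 1 (f⁻¹ * v) := by
  simp [theta]

theorem connForm_act {m : ℕ} {h : Mat m} (hh : h ∈ SO m) (f v : Mat (m + 1)) :
    (connForm (f * embed h) (v * embed h) : Mat m) = hᵀ * (connForm f v : Mat m) * h := by
  simp only [connForm]
  rw [theta_eq, inv_mul_conj hh, theta_conj, block_conj, ← theta_eq]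

theorem horizontalLift_act {m : ℕ} {h : Mat m} (hh : h ∈ SO m) (f : Frame m) (x : Vec m) :
    horizontalLift (f.act h hh) x = horizontalLift f x * embed h := by
  have e1 : (embed h)ᵀ *ᵥ eLast m = eLast m := by
    rw [← embed_transpose, embed_mulVec_eLast]
  have e2 : eLast m ᵥ* embed h = eLast m := by
    rw [← Matrix.mulVec_transpose, e1]
  have e3 : (f.act h hh).mat⁻¹ *ᵥ x.ofLp = (embed h)ᵀ *ᵥ (f.mat⁻¹ *ᵥ x.ofLp) := by
    simp [Frame.act, Matrix.mul_inv_rev, SO.embed_inv hh]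
  set y : Fin (m + 1) → ℝ := f.mat⁻¹ *ᵥ x.ofLp with hy
  have e4 : ((embed h)ᵀ *ᵥ y) (Fin.last m) = y (Fin.last m) := by
    have a1 : ∀ z : Fin (m + 1) → ℝ, z (Fin.last m) = z ⬝ᵥ eLast m := by
      intro z; simp [eLast]
    rw [a1 ((embed h)ᵀ *ᵥ y), a1 y, Matrix.mulVec_transpose, ← Matrix.dotProduct_mulVec, embed_mulVec_eLast]
  have e5 : embed h * Matrix.vecMulVec ((embed h)ᵀ *ᵥ y) (eLast m)
      = Matrix.vecMulVec y (eLast m) * embed h := by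
    rw [Matrix.mul_vecMulVec, Matrix.vecMulVec_mul, e2, Matrix.mulVec_mulVec,
      SO.embed_mul_transpose hh, Matrix.one_mulVec]
  have e6 : embed h * Matrix.vecMulVec (eLast m) ((embed h)ᵀ *ᵥ y)
      = Matrix.vecMulVec (eLast m) y * embed h := by
    rw [Matrix.mul_vecMulVec, Matrix.vecMulVec_mul, embed_mulVec_eLast, Matrix.mulVec_transpose]
  simp only [horizontalLift, e3, e4, ← hy]
  simp only [Frame.act, Matrix.mul_assoc]
  congr 1
  rw [Matrix.mul_add, Matrix.mul_sub, e5, e6]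
  simp [Matrix.add_mul, Matrix.sub_mul]

/-- Equivariance of the curvature, so that `[f, curvature f x y]` does not depend on `f`. -/
theorem curvature_act {m : ℕ} {h : Mat m} (hh : h ∈ SO m) (f : Frame m) (x y : Vec m) :
    curvature (f.act h hh) x y = adInv h (curvature f x y) := by
  have key : ∀ v w : Mat (m + 1), (f.mat * embed h)⁻¹ * (v * embed h)
        * ((f.mat * embed h)⁻¹ * (w * embed h))
      = (embed h)ᵀ * (f.mat⁻¹ * v * (f.mat⁻¹ * w)) * embed h := by
    intro v w
    rw [inv_mul_conj hh, inv_mul_conj hh]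
    calc _ = (embed h)ᵀ * (f.mat⁻¹ * v) * (embed h * (embed h)ᵀ) * (f.mat⁻¹ * w) * embed h := by
          simp only [Matrix.mul_assoc]
      _ = _ := by rw [SO.embed_mul_transpose hh]; simp only [Matrix.mul_one, Matrix.mul_assoc]
  have key2 : ∀ v w : Mat (m + 1),
      (theta 1 (-((f.mat * embed h)⁻¹ * (v * embed h)
        * ((f.mat * embed h)⁻¹ * (w * embed h))))).submatrix Fin.castSucc Fin.castSucc
      = hᵀ * (theta 1 (-(f.mat⁻¹ * v * (f.mat⁻¹ * w)))).submatrix Fin.castSucc Fin.castSucc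
          * h := by
    intro v w
    rw [key, ← block_conj, ← theta_conj]
    simp
  apply Subtype.ext
  simp only [curvature, adInv, structureForm]
  rw [dConnForm_eq (f.act h hh).isUnit_det, dConnForm_eq f.isUnit_det, horizontalLift_act hh,
    horizontalLift_act hh, connForm_horizontalLift, connForm_horizontalLift]
  simp only [← horizontalLift_act hh, connForm_horizontalLift]
  simp only [horizontalLift_act hh]
  rw [show (f.act h hh).mat = f.mat * embed h from rfl, key2, key2]
  simp [Matrix.mul_sub, Matrix.sub_mul]

/-- The vector `φ · F(x, ·)`: the one-form obtained by pairing `φ` with `F(x, ·)` in the fibre, turned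
into a vector by the Euclidean metric. Its `j`-th coordinate is `⟨φ, F(x, e_j)⟩`. -/
def AdBundle.dotCurvature {m : ℕ} (φ : AdBundle m) (x : Vec m) : Vec m :=
  Quotient.lift
    (fun p : Frame m × so m => (WithLp.toLp 2 fun j : Fin (m + 1) =>
      soInner p.2 (curvature p.1 x (EuclideanSpace.single j 1)) : Vec m)) (by
    rintro p _ ⟨h, hh, rfl⟩
    simp only [curvature_act hh, soInner_adInv hh]) φ

/-! ### The MICZ-Kepler system and the data of its solutions -/

/-- The covariant derivative `Dφ/dt = ψ` at time `t` of a curve `φ` in the adjoint bundle: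
if `φ = [f, X]` near `t` then `Dφ/dt = [f, X' + [A(f'), X]]`. -/
def HasCovDerivAt {m : ℕ} (φ : ℝ → AdBundle m) (ψ : AdBundle m) (t : ℝ) : Prop :=
  ∃ (f : ℝ → Frame m) (X : ℝ → so m) (f' : Mat (m + 1)) (X' : so m),
    (∀ᶠ s in nhds t, φ s = AdBundle.mk (f s) (X s)) ∧
    HasDerivAt (fun s => (f s).mat) f' t ∧
    HasDerivAt (fun s => (X s : Mat m)) (X' : Mat m) t ∧
    ψ = AdBundle.mk (f t) (X' + ⁅connForm (f t).mat f', X t⁆)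

/-- `(q, φ)` solves the generalized MICZ-Kepler system on the open interval `I`: `φ(t)` lies in the
fibre over `q(t)`, `q'' = -q/r³ + |φ|² q/r⁴ + φ · F(q', ·)` with `r = |q|`, and `Dφ/dt = 0`. -/
structure IsMICZKeplerSolution {m : ℕ} (I : Set ℝ) (q : ℝ → Vec m) (φ : ℝ → AdBundle m) :
    Prop where
  base : ∀ t ∈ I, (φ t).proj = q t
  differentiable : ∀ t ∈ I, DifferentiableAt ℝ q t
  newton : ∀ t ∈ I, HasDerivAt (deriv q)
    (-((1 / ‖q t‖ ^ 3) • q t) + ((φ t).normSq / ‖q t‖ ^ 4) • q t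
      + (φ t).dotCurvature (deriv q t)) t
  parallel : ∀ t ∈ I, ∃ ψ : AdBundle m, ψ.IsZero ∧ HasCovDerivAt φ ψ t

/-- `f` is a horizontal lift of `q` on `I`. -/
def IsHorizontalLift {m : ℕ} (I : Set ℝ) (q : ℝ → Vec m) (f : ℝ → Frame m) : Prop :=
  ∀ t ∈ I, (f t).proj = q t ∧
    ∃ f' : Mat (m + 1), HasDerivAt (fun s => (f s).mat) f' t ∧ connForm (f t).mat f' = 0

/-- On `I`, `φ` is the parallel transport along `q` of the adjoint vector `[f₀, X]` at time `t₀`: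
`φ(t) = [f(t), X]` for the horizontal lift `f` of `q` with `f(t₀) = f₀`. -/
def IsParallelTransport {m : ℕ} (I : Set ℝ) (q : ℝ → Vec m) (t₀ : ℝ) (f₀ : Frame m) (X : so m)
    (φ : ℝ → AdBundle m) : Prop :=
  ∃ f : ℝ → Frame m, IsHorizontalLift I q f ∧ f t₀ = f₀ ∧ ∀ t ∈ I, φ t = AdBundle.mk (f t) X

/-- `A_f(ξ)`: the connection form at `f` on the infinitesimal generator `ξ f` of the action of
`exp(tξ) ∈ SO(n)` on frames. -/
def connGen {m : ℕ} (f : Frame m) (ξ : so (m + 1)) : so m :=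
  connForm f.mat ((ξ : Mat (m + 1)) * f.mat)

/-- The effective potential `V(r) = -1/r + μ²/(2 r²)`, as a function of `μ²` and `r`. -/
def effectivePotential (μsq r : ℝ) : ℝ := -(1 / r) + μsq / (2 * r ^ 2)

/-- `r` is a positive solution on `I` of the one-dimensional Kepler problem `r'' = -V'(r)`. -/
structure IsRadialSolution (I : Set ℝ) (μsq : ℝ) (r : ℝ → ℝ) : Prop where
  pos : ∀ t ∈ I, 0 < r t
  differentiable : ∀ t ∈ I, DifferentiableAt ℝ r t
  newton : ∀ t ∈ I, HasDerivAt (deriv r) (-deriv (effectivePotential μsq) (r t)) t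

/-- The curve `r exp(uξ) w` in `ℝⁿ`. -/
def rotatedCurve {m : ℕ} (ξ : so (m + 1)) (w : Vec m) (r u : ℝ) : Vec m :=
  r • Matrix.toEuclideanLin (NormedSpace.exp (u • (ξ : Mat (m + 1)))) w

end MICZ

end

open scoped Matrix

noncomputable section

namespace MICZ

attribute [local instance 100] LieRing.ofAssociativeRing

/-! The proof removes the frames. An element `[f, X]` over `q` is the same as the skew endomorphism
`Φ = f diag(X, 0) f⁻¹` of `ℝⁿ`, which kills `q` and determines `[f, X]` together with `q`
(`AdBundle.ext_toSkew`). In this language, with `r = |q|`, the magnetic force is `r⁻² Φ q'`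
(`AdBundle.dotCurvature_eq`), and a parallel section satisfies `Φ' = r⁻² [q' ∧ q, Φ]`
(`HasCovDerivAt.hasDerivAt_toSkew`).

For a solution, `ξ = Φ + q' ∧ q` is conserved (`IsMICZKeplerSolution.hasDerivAt_momentum`): central
forces drop out of `q'' ∧ q`, and since `Φ q = 0` the bracket `[q' ∧ q, Φ]` equals `-(Φ q') ∧ q`,
which cancels the magnetic term. Applying `ξ` to `q` gives `ξ q = r² q' - (q · q') q`, so the unit
vector `q/r` has derivative `r⁻² ξ (q/r)`. Hence `q/r = exp(uξ) w` with `u' = r⁻²`. The summands `Φ`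
and `q' ∧ q` are orthogonal, so `|ξ|² = |Φ|² + |q'|² r² - (q · q')²`, which turns the equation for
`r` into the one-dimensional Kepler problem.

Such a curve has an explicit horizontal lift: with `η` the image of `A_{f₀}(ξ)` in `so(n)`, it is
`(r/r₀) exp(sξ) f₀ exp(-sη)`, where `r₀ = r(t₀)` and `s = u - u(t₀)`. Along it `A_f(ξ)` keeps its
initial value (`Frame.connGen_orbit`), so transporting `[f₀, A_{f₀}(ξ)]` yields `[f, A_f(ξ)]`, whose
skew matrix is `ξ - r⁻² (ξ q) ∧ q`. For a solution this is `Φ`, which finishes the first half. For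
the converse, uniqueness of parallel transport forces this formula on every admissible `φ`, and the
equation of motion becomes a direct computation with the unit vector `q/r`. -/

/-! ### The block inclusion of matrices -/

/-- The inclusion `so(n-1) ⊂ so(n)`, `X ↦ diag(X, 0)`, on all matrices. -/
def corner {m : ℕ} (X : Mat m) : Mat (m + 1) :=
  Matrix.reindex finSumFinEquiv finSumFinEquiv
    (Matrix.fromBlocks X 0 0 (0 : Matrix (Fin 1) (Fin 1) ℝ))

theorem corner_castSucc {m : ℕ} (X : Mat m) (i j : Fin m) :
    corner X i.castSucc j.castSucc = X i j := by
  simp [corner]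

theorem corner_last_left {m : ℕ} (X : Mat m) (j : Fin (m + 1)) :
    corner X (Fin.last m) j = 0 := by
  refine Fin.lastCases ?_ (fun j => ?_) j <;> simp [corner, finSumFinEquiv_symm_last]

theorem corner_last_right {m : ℕ} (X : Mat m) (i : Fin (m + 1)) :
    corner X i (Fin.last m) = 0 := by
  refine Fin.lastCases ?_ (fun i => ?_) i <;> simp [corner, finSumFinEquiv_symm_last]

theorem corner_submatrix {m : ℕ} (X : Mat m) :
    (corner X).submatrix Fin.castSucc Fin.castSucc = X := by
  ext i j; exact corner_castSucc X i j

theorem corner_injective {m : ℕ} {X Y : Mat m} (h : corner X = corner Y) : X = Y := by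
  rw [← corner_submatrix X, h, corner_submatrix]

theorem corner_transpose {m : ℕ} (X : Mat m) : corner Xᵀ = (corner X)ᵀ := by
  simp [corner, Matrix.fromBlocks_transpose]

theorem corner_mul {m : ℕ} (X Y : Mat m) : corner (X * Y) = corner X * corner Y := by
  simp [corner, Matrix.fromBlocks_multiply, Matrix.submatrix_mul_equiv]

theorem corner_add {m : ℕ} (X Y : Mat m) : corner (X + Y) = corner X + corner Y := by
  ext i j
  refine Fin.lastCases ?_ (fun i => ?_) i
  · simp [corner_last_left]
  · refine Fin.lastCases ?_ (fun j => ?_) j <;> simp [corner_last_right, corner_castSucc]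

theorem corner_smul {m : ℕ} (c : ℝ) (X : Mat m) : corner (c • X) = c • corner X := by
  ext i j
  refine Fin.lastCases ?_ (fun i => ?_) i
  · simp [corner_last_left]
  · refine Fin.lastCases ?_ (fun j => ?_) j <;> simp [corner_last_right, corner_castSucc]

theorem corner_sub {m : ℕ} (X Y : Mat m) : corner (X - Y) = corner X - corner Y := by
  rw [sub_eq_add_neg, ← neg_one_smul ℝ, corner_add, corner_smul, neg_one_smul, sub_eq_add_neg]

theorem corner_zero {m : ℕ} : corner (0 : Mat m) = 0 := by
  simpa using corner_smul (0 : ℝ) (0 : Mat m)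

theorem corner_trace {m : ℕ} (X : Mat m) : (corner X).trace = X.trace := by
  simp [Matrix.trace, Fin.sum_univ_castSucc, corner_castSucc, corner_last_left]

theorem corner_conj {m : ℕ} (h X k : Mat m) :
    corner (h * X * k) = embed h * corner X * embed k := by
  simp [corner, embed, Matrix.fromBlocks_multiply, Matrix.submatrix_mul_equiv]

theorem corner_mulVec_eLast {m : ℕ} (X : Mat m) : corner X *ᵥ eLast m = 0 := by
  ext i
  simp [eLast, corner_last_right]

theorem mem_so_iff {k : ℕ} (X : Mat k) : X ∈ so k ↔ Xᵀ = -X :=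
  LieAlgebra.Orthogonal.mem_so (Fin k) ℝ X

theorem so_transpose {k : ℕ} (X : so k) : (X : Mat k)ᵀ = -X := (mem_so_iff _).1 X.2

theorem mulVec_eLast {m : ℕ} (M : Mat (m + 1)) (i : Fin (m + 1)) :
    (M *ᵥ eLast m) i = M i (Fin.last m) := by
  simp [eLast]

/-- A skew matrix that kills `e_n` is the inclusion of its block. -/
theorem corner_block {m : ℕ} {M : Mat (m + 1)} (hM : Mᵀ = -M) (h0 : M *ᵥ eLast m = 0) :
    corner (M.submatrix Fin.castSucc Fin.castSucc) = M := by
  have h1 : ∀ i, M i (Fin.last m) = 0 := fun i => by rw [← mulVec_eLast M, h0]; rfl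
  have h2 : ∀ i, M (Fin.last m) i = 0 := fun i => by
    have := congrFun (congrFun hM i) (Fin.last m)
    rw [Matrix.transpose_apply, Matrix.neg_apply, h1, neg_zero] at this
    exact this
  ext i j
  refine Fin.lastCases ?_ (fun i => ?_) i
  · rw [corner_last_left, h2]
  · refine Fin.lastCases ?_ (fun j => ?_) j
    · rw [corner_last_right, h1]
    · rw [corner_castSucc]; rfl

/-! ### Wedges of vectors and their pairing with skew matrices -/

/-- `x ∧ y = x yᵀ - y xᵀ`. -/
def wedge {k : ℕ} (x y : Fin k → ℝ) : Mat k := Matrix.vecMulVec x y - Matrix.vecMulVec y x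

theorem wedge_transpose {k : ℕ} (x y : Fin k → ℝ) : (wedge x y)ᵀ = -wedge x y := by
  simp [wedge, Matrix.transpose_vecMulVec]

theorem wedge_mulVec {k : ℕ} (x y z : Fin k → ℝ) :
    wedge x y *ᵥ z = (y ⬝ᵥ z) • x - (x ⬝ᵥ z) • y := by
  ext i
  simp [wedge, Matrix.sub_mulVec, Matrix.vecMulVec_mulVec, mul_comm]

theorem mul_wedge_mul_transpose {k : ℕ} (M : Mat k) (x y : Fin k → ℝ) :
    M * wedge x y * Mᵀ = wedge (M *ᵥ x) (M *ᵥ y) := by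
  simp [wedge, Matrix.mul_sub, Matrix.sub_mul, Matrix.mul_vecMulVec, Matrix.vecMulVec_mul,
    Matrix.vecMul_transpose]

theorem wedge_smul_right {k : ℕ} (x y : Fin k → ℝ) (c : ℝ) :
    wedge x (c • y) = c • wedge x y := by
  simp [wedge, Matrix.vecMulVec_smul, Matrix.smul_vecMulVec, smul_sub]

theorem wedge_smul_left {k : ℕ} (x y : Fin k → ℝ) (c : ℝ) :
    wedge (c • x) y = c • wedge x y := by
  simp [wedge, Matrix.vecMulVec_smul, Matrix.smul_vecMulVec, smul_sub]

theorem wedge_add_left {k : ℕ} (x y z : Fin k → ℝ) :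
    wedge (x + y) z = wedge x z + wedge y z := by
  simp only [wedge, Matrix.add_vecMulVec, Matrix.vecMulVec_add]; abel

theorem wedge_self {k : ℕ} (x : Fin k → ℝ) : wedge x x = 0 := sub_self _

theorem skew_dotProduct {k : ℕ} {M : Mat k} (hM : Mᵀ = -M) (x y : Fin k → ℝ) :
    (M *ᵥ x) ⬝ᵥ y = -(x ⬝ᵥ (M *ᵥ y)) := by
  rw [← Matrix.vecMul_transpose, ← Matrix.dotProduct_mulVec, hM, Matrix.neg_mulVec,
    dotProduct_neg]

theorem skew_dotProduct_self {k : ℕ} {M : Mat k} (hM : Mᵀ = -M) (x : Fin k → ℝ) :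
    x ⬝ᵥ (M *ᵥ x) = 0 := by
  have := skew_dotProduct hM x x
  rw [dotProduct_comm] at this
  linarith

theorem trace_transpose_mul_wedge {k : ℕ} {M : Mat k} (hM : Mᵀ = -M) (x y : Fin k → ℝ) :
    (Mᵀ * wedge x y).trace = 2 * (x ⬝ᵥ (M *ᵥ y)) := by
  have h := skew_dotProduct hM x y
  have h' := dotProduct_comm (M *ᵥ x) y
  rw [hM]
  simp only [wedge, Matrix.mul_sub, Matrix.mul_vecMulVec, Matrix.trace_sub,
    Matrix.trace_vecMulVec, Matrix.neg_mulVec, neg_dotProduct]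
  rw [h, dotProduct_comm (M *ᵥ y) x]
  ring

/-! ### Frames -/

theorem normSq_eq_dotProduct {m : ℕ} (x : Vec m) : ‖x‖ ^ 2 = x.ofLp ⬝ᵥ x.ofLp := by
  rw [EuclideanSpace.real_norm_sq_eq]
  simp [dotProduct, sq]

theorem Frame.mulVec_eLast {m : ℕ} (f : Frame m) : f.mat *ᵥ eLast m = f.proj.ofLp := by
  rw [Frame.proj_eq]

/-- The radius in `Frame.conformal` is only asserted to exist; evaluating the quadratic form at
`e_n` identifies it with the length of the last column, the base point. -/
theorem Frame.transpose_mul {m : ℕ} (f : Frame m) :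
    f.matᵀ * f.mat = ‖f.proj‖ ^ 2 • (1 : Mat (m + 1)) := by
  obtain ⟨r, hr, h⟩ := f.conformal
  have h1 : ‖f.proj‖ ^ 2 = r ^ 2 := by
    rw [normSq_eq_dotProduct, ← f.mulVec_eLast, Matrix.dotProduct_mulVec, ← Matrix.mulVec_transpose,
      Matrix.mulVec_mulVec, h]
    simp [eLast]
  rw [h1, h]

theorem Frame.norm_proj_pos {m : ℕ} (f : Frame m) : 0 < ‖f.proj‖ := by
  refine lt_of_le_of_ne (norm_nonneg _) fun h => ?_
  have h1 := f.transpose_mul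
  rw [← h] at h1
  have h2 := congrArg Matrix.det h1
  have h3 := f.det_pos
  simp [Matrix.det_mul, Matrix.det_zero] at h2
  exact h3.ne' h2

/-- Being a multiple of a rotation, a frame has its transpose as inverse up to scale. This is why
conjugation by a frame preserves skewness. -/
theorem Frame.inv_eq {m : ℕ} (f : Frame m) : f.mat⁻¹ = (‖f.proj‖ ^ 2)⁻¹ • f.matᵀ := by
  have := f.norm_proj_pos
  refine Matrix.inv_eq_left_inv ?_
  rw [Matrix.smul_mul, f.transpose_mul, smul_smul, inv_mul_cancel₀ (by positivity), one_smul]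

theorem Frame.inv_mul {m : ℕ} (f : Frame m) : f.mat⁻¹ * f.mat = 1 :=
  Matrix.nonsing_inv_mul _ f.isUnit_det

theorem Frame.mul_inv {m : ℕ} (f : Frame m) : f.mat * f.mat⁻¹ = 1 :=
  Matrix.mul_nonsing_inv _ f.isUnit_det

theorem Frame.inv_mulVec_proj {m : ℕ} (f : Frame m) : f.mat⁻¹ *ᵥ f.proj.ofLp = eLast m := by
  rw [← f.mulVec_eLast, Matrix.mulVec_mulVec, f.inv_mul, Matrix.one_mulVec]

theorem Frame.conj_transpose {m : ℕ} (f : Frame m) (M : Mat (m + 1)) :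
    (f.mat * M * f.mat⁻¹)ᵀ = f.mat * Mᵀ * f.mat⁻¹ := by
  rw [f.inv_eq]
  simp [Matrix.transpose_mul, Matrix.mul_assoc]

theorem Frame.inv_conj_transpose {m : ℕ} (f : Frame m) (M : Mat (m + 1)) :
    (f.mat⁻¹ * M * f.mat)ᵀ = f.mat⁻¹ * Mᵀ * f.mat := by
  rw [f.inv_eq]
  simp [Matrix.transpose_mul, Matrix.mul_assoc]

theorem Frame.conj_inv_conj {m : ℕ} (f : Frame m) (M : Mat (m + 1)) :
    f.mat * (f.mat⁻¹ * M * f.mat) * f.mat⁻¹ = M := by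
  calc _ = (f.mat * f.mat⁻¹) * M * (f.mat * f.mat⁻¹) := by simp only [Matrix.mul_assoc]
    _ = M := by rw [f.mul_inv, Matrix.one_mul, Matrix.mul_one]

theorem Frame.inv_conj_conj {m : ℕ} (f : Frame m) (M : Mat (m + 1)) :
    f.mat⁻¹ * (f.mat * M * f.mat⁻¹) * f.mat = M := by
  calc _ = (f.mat⁻¹ * f.mat) * M * (f.mat⁻¹ * f.mat) := by simp only [Matrix.mul_assoc]
    _ = M := by rw [f.inv_mul, Matrix.one_mul, Matrix.mul_one]

theorem Frame.conj_wedge {m : ℕ} (f : Frame m) (x y : Fin (m + 1) → ℝ) :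
    f.mat * wedge x y * f.mat⁻¹
      = (‖f.proj‖ ^ 2)⁻¹ • wedge (f.mat *ᵥ x) (f.mat *ᵥ y) := by
  rw [f.inv_eq, Matrix.mul_smul, mul_wedge_mul_transpose]

/-- Frames over the same point differ by an element of `SO(n-1)`. -/
theorem Frame.exists_act {m : ℕ} (f g : Frame m) (h : f.proj = g.proj) :
    ∃ (k : Mat m) (hk : k ∈ SO m), g = f.act k hk := by
  set K : Mat (m + 1) := f.mat⁻¹ * g.mat with hK
  have hgK : g.mat = f.mat * K := by rw [hK, ← Matrix.mul_assoc, f.mul_inv, Matrix.one_mul]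
  have hpos := f.norm_proj_pos
  have hKK : Kᵀ * K = 1 := by
    have h1 := g.transpose_mul
    rw [hgK, Matrix.transpose_mul, Matrix.mul_assoc, ← Matrix.mul_assoc f.matᵀ, f.transpose_mul,
      ← h, Matrix.smul_mul, Matrix.one_mul, Matrix.mul_smul] at h1
    exact smul_right_injective _ (by positivity : ‖f.proj‖ ^ 2 ≠ 0) h1
  have hdet : 0 < K.det := by
    have h1 := g.det_pos
    rw [hgK, Matrix.det_mul] at h1
    exact pos_of_mul_pos_right h1 f.det_pos.le
  have hdet1 : K.det = 1 := by
    have h1 := congrArg Matrix.det hKK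
    rw [Matrix.det_mul, Matrix.det_transpose, Matrix.det_one] at h1
    nlinarith
  have hKe : K *ᵥ eLast m = eLast m := by
    rw [hK, ← Matrix.mulVec_mulVec, g.mulVec_eLast, ← h, f.inv_mulVec_proj]
  have hKe' : Kᵀ *ᵥ eLast m = eLast m := by
    conv_lhs => rw [← hKe]
    rw [Matrix.mulVec_mulVec, hKK, Matrix.one_mulVec]
  -- Both `K` and `Kᵀ` fix `e_n`, so the last column and the last row of `K` are those of the
  -- identity.
  have h1 : K = embed (K.submatrix Fin.castSucc Fin.castSucc) := by
    have a1 : ∀ i, K i (Fin.last m) = eLast m i := fun i => by rw [← MICZ.mulVec_eLast K, hKe]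
    have a2 : ∀ i, K (Fin.last m) i = eLast m i := fun i => by
      rw [← Matrix.transpose_apply K, ← MICZ.mulVec_eLast Kᵀ, hKe']
    ext i j
    refine Fin.lastCases ?_ (fun i => ?_) i
    · rw [a2]
      refine Fin.lastCases ?_ (fun j => ?_) j
      · simp [embed, finSumFinEquiv_symm_last, eLast]
      · simp [embed_last_castSucc, eLast]
    · refine Fin.lastCases ?_ (fun j => ?_) j
      · rw [a1]; simp [embed, finSumFinEquiv_symm_last, eLast]
      · simp [embed_castSucc]
  set k := K.submatrix Fin.castSucc Fin.castSucc with hk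
  have hkk : kᵀ * k = 1 := by
    rw [h1, ← embed_transpose, ← embed_mul, ← embed_one] at hKK
    ext i j
    have := congrFun (congrFun hKK i.castSucc) j.castSucc
    rwa [embed_castSucc, embed_castSucc] at this
  refine ⟨k, ?_, ?_⟩
  · refine Matrix.mem_specialOrthogonalGroup_iff.2
      ⟨(Matrix.mem_orthogonalGroup_iff' (Fin m) ℝ).2 ?_, ?_⟩
    · simpa [Matrix.star_eq_conjTranspose] using hkk
    · rw [← embed_det, ← h1, hdet1]
  · apply Frame.ext
    rw [hgK]
    exact congrArg (f.mat * ·) h1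

/-! ### The adjoint bundle as pairs of a base point and a skew matrix that kills it -/

/-- The skew endomorphism `f diag(X, 0) f⁻¹` of `ℝⁿ` that `[f, X]` stands for. -/
def AdBundle.toSkew {m : ℕ} (φ : AdBundle m) : Mat (m + 1) :=
  Quotient.lift (fun p : Frame m × so m => p.1.mat * corner (p.2 : Mat m) * p.1.mat⁻¹) (by
    rintro p _ ⟨h, hh, rfl⟩
    have h1 := SO.embed_mul_transpose hh
    simp only [Frame.act, adInv, corner_conj, Matrix.mul_inv_rev, SO.embed_inv hh, embed_transpose]
    calc p.1.mat * corner (p.2 : Mat m) * p.1.mat⁻¹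
        = p.1.mat * (embed h * (embed h)ᵀ) * corner (p.2 : Mat m) * (embed h * (embed h)ᵀ)
          * p.1.mat⁻¹ := by rw [h1, Matrix.mul_one, Matrix.mul_one]
      _ = _ := by simp only [Matrix.mul_assoc]) φ

theorem AdBundle.toSkew_mk {m : ℕ} (f : Frame m) (X : so m) :
    (AdBundle.mk f X).toSkew = f.mat * corner (X : Mat m) * f.mat⁻¹ := rfl

theorem AdBundle.proj_mk {m : ℕ} (f : Frame m) (X : so m) : (AdBundle.mk f X).proj = f.proj := rfl

theorem AdBundle.exists_mk {m : ℕ} (φ : AdBundle m) : ∃ f X, φ = AdBundle.mk f X := by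
  obtain ⟨⟨f, X⟩, h⟩ := Quotient.exists_rep φ
  exact ⟨f, X, h.symm⟩

theorem AdBundle.toSkew_transpose {m : ℕ} (φ : AdBundle m) : φ.toSkewᵀ = -φ.toSkew := by
  obtain ⟨f, X, rfl⟩ := φ.exists_mk
  rw [toSkew_mk, f.conj_transpose, ← corner_transpose, so_transpose, ← neg_one_smul ℝ (X : Mat m),
    corner_smul]
  simp

theorem AdBundle.toSkew_mulVec_proj {m : ℕ} (φ : AdBundle m) : φ.toSkew *ᵥ φ.proj.ofLp = 0 := by
  obtain ⟨f, X, rfl⟩ := φ.exists_mk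
  rw [toSkew_mk, proj_mk, ← Matrix.mulVec_mulVec, f.inv_mulVec_proj, ← Matrix.mulVec_mulVec,
    corner_mulVec_eLast, Matrix.mulVec_zero]

theorem AdBundle.norm_proj_pos {m : ℕ} (φ : AdBundle m) : 0 < ‖φ.proj‖ := by
  obtain ⟨f, X, rfl⟩ := φ.exists_mk
  exact f.norm_proj_pos

/-- Frames over one point differ by `SO(n-1)`, so both classes can be written with the same frame;
conjugation by that frame is injective. -/
theorem AdBundle.ext_toSkew {m : ℕ} {φ ψ : AdBundle m} (h1 : φ.proj = ψ.proj)
    (h2 : φ.toSkew = ψ.toSkew) : φ = ψ := by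
  obtain ⟨f, X, rfl⟩ := φ.exists_mk
  obtain ⟨g, Y, rfl⟩ := ψ.exists_mk
  obtain ⟨k, hk, rfl⟩ := f.exists_act g h1
  have h3 : AdBundle.mk f X = AdBundle.mk (f.act k hk) (adInv k X) :=
    Quotient.sound ⟨k, hk, rfl⟩
  rw [h3] at h2 ⊢
  rw [toSkew_mk, toSkew_mk] at h2
  have h4 := congrArg (fun M => (f.act k hk).mat⁻¹ * M * (f.act k hk).mat) h2
  simp only [Frame.inv_conj_conj] at h4
  rw [Subtype.ext (corner_injective h4)]

/-- The zero class may be represented with a different frame, but its skew matrix is zero in every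
frame. -/
theorem AdBundle.eq_zero_of_isZero {m : ℕ} {f : Frame m} {X : so m}
    (h : (AdBundle.mk f X).IsZero) : X = 0 := by
  obtain ⟨g, hg⟩ := h
  have h2 := congrArg AdBundle.toSkew hg
  rw [toSkew_mk, toSkew_mk] at h2
  have h4 := congrArg (fun M => f.mat⁻¹ * M * f.mat) h2
  simp only [Frame.inv_conj_conj] at h4
  apply Subtype.ext
  apply corner_injective
  rw [h4]
  simp [corner_zero]

/-- `[f, X]` is determined by its skew endomorphism `Φ`: `X` is the block of `f⁻¹ Φ f`. -/
theorem AdBundle.toSkew_mk_eq {m : ℕ} (f : Frame m) (X : so m) {M : Mat (m + 1)} (hM : Mᵀ = -M)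
    (h0 : M *ᵥ f.proj.ofLp = 0)
    (hX : (f.mat⁻¹ * M * f.mat).submatrix Fin.castSucc Fin.castSucc = X) :
    (AdBundle.mk f X).toSkew = M := by
  rw [toSkew_mk, ← hX, corner_block, f.conj_inv_conj]
  · rw [f.inv_conj_transpose, hM]; simp
  · rw [← Matrix.mulVec_mulVec, f.mulVec_eLast, ← Matrix.mulVec_mulVec, h0, Matrix.mulVec_zero]

theorem AdBundle.normSq_eq {m : ℕ} (φ : AdBundle m) :
    φ.normSq = (1 / 2) * (φ.toSkewᵀ * φ.toSkew).trace := by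
  obtain ⟨f, X, rfl⟩ := φ.exists_mk
  rw [toSkew_mk, f.conj_transpose, ← corner_transpose]
  have h1 : f.mat * corner (X : Mat m)ᵀ * f.mat⁻¹ * (f.mat * corner (X : Mat m) * f.mat⁻¹)
      = f.mat * (corner ((X : Mat m)ᵀ * (X : Mat m)) * f.mat⁻¹) := by
    calc _ = f.mat * corner (X : Mat m)ᵀ * (f.mat⁻¹ * f.mat) * corner (X : Mat m) * f.mat⁻¹ := by
          simp only [Matrix.mul_assoc]
      _ = _ := by rw [f.inv_mul, Matrix.mul_one, corner_mul]; simp only [Matrix.mul_assoc]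
  rw [h1, Matrix.trace_mul_comm, Matrix.mul_assoc, f.inv_mul, Matrix.mul_one, corner_trace]
  rfl

/-! ### The curvature and the magnetic force -/

/-- The bracket term vanishes on horizontal lifts, leaving only `-dA`. In frame coordinates `a =
f⁻¹x`, `b = f⁻¹y` it is the `so(n-1)`-block of `b ∧ a`. -/
theorem curvature_apply {m : ℕ} (f : Frame m) (x y : Vec m) (i j : Fin m) :
    (curvature f x y : Mat m) i j
      = (f.mat⁻¹ *ᵥ y.ofLp) i.castSucc * (f.mat⁻¹ *ᵥ x.ofLp) j.castSucc
        - (f.mat⁻¹ *ᵥ x.ofLp) i.castSucc * (f.mat⁻¹ *ᵥ y.ofLp) j.castSucc := by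
  simp only [curvature, structureForm, dConnForm_eq f.isUnit_det, connForm_horizontalLift]
  simp only [horizontalLift, Matrix.nonsing_inv_mul_cancel_left _ _ f.isUnit_det]
  generalize f.mat⁻¹ *ᵥ x.ofLp = a
  generalize f.mat⁻¹ *ᵥ y.ofLp = b
  -- The diagonal contribution `a_n b_n δ_ij` is symmetric in `i`, `j` and disappears when the skew
  -- part is taken.
  have key : ∀ (a b : Fin (m + 1) → ℝ) (i j : Fin m),
      ((a (Fin.last m) • (1 : Mat (m + 1))
        + (Matrix.vecMulVec a (eLast m) - Matrix.vecMulVec (eLast m) a))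
        * (b (Fin.last m) • (1 : Mat (m + 1))
        + (Matrix.vecMulVec b (eLast m) - Matrix.vecMulVec (eLast m) b))) i.castSucc j.castSucc
      = a (Fin.last m) * b (Fin.last m) * (1 : Mat m) i j - a i.castSucc * b j.castSucc := by
    intro a b i j
    have h0 : ∀ j : Fin m, Fin.last m ≠ j.castSucc := fun j => (Fin.castSucc_lt_last j).ne'
    simp [Matrix.mul_apply, Fin.sum_univ_castSucc, Matrix.vecMulVec_apply, eLast,
      Matrix.one_apply, h0]
    split_ifs <;> ring
  have h1 : (1 : Mat m) i j = (1 : Mat m) j i := by simp [Matrix.one_apply, eq_comm]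
  simp only [theta, inv_one, Matrix.one_mul, Matrix.neg_apply, Matrix.add_apply, Matrix.sub_apply,
    Matrix.submatrix_apply, Matrix.smul_apply, Matrix.transpose_apply, key, h1, smul_eq_mul,
    ZeroMemClass.coe_zero, lie_self, Matrix.zero_apply]
  ring

theorem soInner_eq_sum {k : ℕ} (X Y : so k) :
    soInner X Y = (1 / 2) * ∑ i, ∑ j, (X : Mat k) i j * (Y : Mat k) i j := by
  simp only [soInner, Matrix.trace, Matrix.diag, Matrix.mul_apply, Matrix.transpose_apply]
  rw [Finset.sum_comm]

theorem soInner_curvature {m : ℕ} (f : Frame m) (X : so m) (x y : Vec m) :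
    soInner X (curvature f x y)
      = (f.mat⁻¹ *ᵥ y.ofLp) ⬝ᵥ (corner (X : Mat m) *ᵥ (f.mat⁻¹ *ᵥ x.ofLp)) := by
  rw [soInner_eq_sum]
  simp only [curvature_apply]
  generalize f.mat⁻¹ *ᵥ x.ofLp = a
  generalize f.mat⁻¹ *ᵥ y.ofLp = b
  -- By skewness of `X` the two halves of the curvature contribute equally, which absorbs the factor
  -- `1/2` of the inner product.
  have h1 : ∑ i, ∑ j, (X : Mat m) i j * (a i.castSucc * b j.castSucc)
      = -∑ i, ∑ j, (X : Mat m) i j * (b i.castSucc * a j.castSucc) := by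
    rw [Finset.sum_comm, ← Finset.sum_neg_distrib]
    refine Finset.sum_congr rfl fun i _ => ?_
    rw [← Finset.sum_neg_distrib]
    refine Finset.sum_congr rfl fun j _ => ?_
    have := congrFun (congrFun (so_transpose X) i) j
    rw [Matrix.transpose_apply, Matrix.neg_apply] at this
    rw [this]; ring
  have h2 : b ⬝ᵥ (corner (X : Mat m) *ᵥ a)
      = ∑ i, ∑ j, (X : Mat m) i j * (b i.castSucc * a j.castSucc) := by
    simp only [dotProduct, Matrix.mulVec, Fin.sum_univ_castSucc, corner_castSucc,
      corner_last_left, corner_last_right, zero_mul, Finset.sum_const_zero, add_zero, mul_zero,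
      Finset.mul_sum]
    refine Finset.sum_congr rfl fun i _ => Finset.sum_congr rfl fun j _ => ?_
    ring
  rw [h2]
  simp only [mul_sub, Finset.sum_sub_distrib]
  rw [h1]
  ring

/-- The curvature pairing is the bilinear form of `diag(X, 0)` in frame coordinates; the factor
`r⁻²` comes from `f⁻¹ e_j = r⁻² fᵀ e_j`. -/
theorem AdBundle.dotCurvature_eq {m : ℕ} (φ : AdBundle m) (x : Vec m) :
    φ.dotCurvature x = WithLp.toLp 2 ((‖φ.proj‖ ^ 2)⁻¹ • (φ.toSkew *ᵥ x.ofLp)) := by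
  obtain ⟨f, X, rfl⟩ := φ.exists_mk
  ext j
  have h1 : (AdBundle.mk f X).dotCurvature x j
      = soInner X (curvature f x (EuclideanSpace.single j 1)) := rfl
  rw [h1, soInner_curvature, proj_mk, toSkew_mk]
  have h2 : (f.mat⁻¹ *ᵥ (EuclideanSpace.single j (1 : ℝ) : Vec m).ofLp)
      = (‖f.proj‖ ^ 2)⁻¹ • (f.mat.row j) := by
    ext i
    simp [f.inv_eq]
  rw [h2, ← Matrix.mulVec_mulVec, ← Matrix.mulVec_mulVec, smul_dotProduct]
  rfl

/-! ### Calculus of matrix and vector valued curves -/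

/-- Working entry by entry avoids the choice of a norm on matrices. -/
theorem hasDerivAt_matrix {k : ℕ} {F : ℝ → Mat k} {F' : Mat k} {t : ℝ} :
    HasDerivAt F F' t ↔ ∀ i j, HasDerivAt (fun s => F s i j) (F' i j) t :=
  hasDerivAt_pi.trans (forall_congr' fun _ => hasDerivAt_pi)

theorem hasDerivAt_matrix_mul {k : ℕ} {F G : ℝ → Mat k} {F' G' : Mat k} {t : ℝ}
    (hF : HasDerivAt F F' t) (hG : HasDerivAt G G' t) :
    HasDerivAt (fun s => F s * G s) (F' * G t + F t * G') t := by
  rw [hasDerivAt_matrix] at *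
  intro i j
  simp only [Matrix.mul_apply, Matrix.add_apply, ← Finset.sum_add_distrib]
  exact HasDerivAt.fun_sum fun l _ => (hF i l).mul (hG l j)

theorem hasDerivAt_matrix_transpose {k : ℕ} {F : ℝ → Mat k} {F' : Mat k} {t : ℝ}
    (hF : HasDerivAt F F' t) : HasDerivAt (fun s => (F s)ᵀ) F'ᵀ t := by
  rw [hasDerivAt_matrix] at *
  exact fun i j => hF j i

theorem hasDerivAt_matrix_smul {k : ℕ} {c : ℝ → ℝ} {F : ℝ → Mat k} {c' : ℝ} {F' : Mat k} {t : ℝ}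
    (hc : HasDerivAt c c' t) (hF : HasDerivAt F F' t) :
    HasDerivAt (fun s => c s • F s) (c' • F t + c t • F') t := by
  rw [hasDerivAt_matrix] at *
  exact fun i j => hc.mul (hF i j)

theorem hasDerivAt_matrix_add {k : ℕ} {F G : ℝ → Mat k} {F' G' : Mat k} {t : ℝ}
    (hF : HasDerivAt F F' t) (hG : HasDerivAt G G' t) :
    HasDerivAt (fun s => F s + G s) (F' + G') t := by
  rw [hasDerivAt_matrix] at *
  exact fun i j => (hF i j).add (hG i j)

theorem hasDerivAt_matrix_sub {k : ℕ} {F G : ℝ → Mat k} {F' G' : Mat k} {t : ℝ}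
    (hF : HasDerivAt F F' t) (hG : HasDerivAt G G' t) :
    HasDerivAt (fun s => F s - G s) (F' - G') t := by
  rw [hasDerivAt_matrix] at *
  exact fun i j => (hF i j).sub (hG i j)

theorem hasDerivAt_matrix_const {k : ℕ} (M : Mat k) (t : ℝ) :
    HasDerivAt (fun _ : ℝ => M) 0 t :=
  hasDerivAt_matrix.2 fun i j => hasDerivAt_const t (M i j)

theorem hasDerivAt_matrix_unique {k : ℕ} {F : ℝ → Mat k} {F' G' : Mat k} {t : ℝ}
    (h1 : HasDerivAt F F' t) (h2 : HasDerivAt F G' t) : F' = G' := by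
  ext i j
  exact (hasDerivAt_matrix.1 h1 i j).unique (hasDerivAt_matrix.1 h2 i j)

theorem hasDerivAt_matrix_congr {k : ℕ} {F G : ℝ → Mat k} {F' : Mat k} {t : ℝ}
    (h : HasDerivAt F F' t) (hG : G =ᶠ[nhds t] F) : HasDerivAt G F' t :=
  hasDerivAt_matrix.2 fun i j => (hasDerivAt_matrix.1 h i j).congr_of_eventuallyEq
    (hG.mono fun _ hs => congrFun (congrFun hs i) j)

theorem hasDerivAt_mulVec {k : ℕ} {F : ℝ → Mat k} {x : ℝ → Fin k → ℝ} {F' : Mat k}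
    {x' : Fin k → ℝ} {t : ℝ} (hF : HasDerivAt F F' t) (hx : HasDerivAt x x' t) :
    HasDerivAt (fun s => F s *ᵥ x s) (F' *ᵥ x t + F t *ᵥ x') t := by
  rw [hasDerivAt_matrix] at hF
  rw [hasDerivAt_pi] at *
  intro i
  simp only [Matrix.mulVec, dotProduct, Pi.add_apply, ← Finset.sum_add_distrib]
  exact HasDerivAt.fun_sum fun l _ => (hF i l).mul (hx l)

theorem hasDerivAt_dotProduct {k : ℕ} {x y : ℝ → Fin k → ℝ} {x' y' : Fin k → ℝ} {t : ℝ}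
    (hx : HasDerivAt x x' t) (hy : HasDerivAt y y' t) :
    HasDerivAt (fun s => x s ⬝ᵥ y s) (x' ⬝ᵥ y t + x t ⬝ᵥ y') t := by
  rw [hasDerivAt_pi] at *
  simp only [dotProduct, ← Finset.sum_add_distrib]
  exact HasDerivAt.fun_sum fun l _ => (hx l).mul (hy l)

theorem hasDerivAt_wedge {k : ℕ} {x y : ℝ → Fin k → ℝ} {x' y' : Fin k → ℝ} {t : ℝ}
    (hx : HasDerivAt x x' t) (hy : HasDerivAt y y' t) :
    HasDerivAt (fun s => wedge (x s) (y s)) (wedge x' (y t) + wedge (x t) y') t := by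
  rw [hasDerivAt_pi] at hx hy
  rw [hasDerivAt_matrix]
  intro i j
  have h := ((hx i).mul (hy j)).sub ((hy i).mul (hx j))
  simp only [wedge, Matrix.sub_apply, Matrix.add_apply, Matrix.vecMulVec_apply]
  convert! h using 1
  ring

theorem hasDerivAt_ofLp {m : ℕ} {q : ℝ → Vec m} {v : Vec m} {t : ℝ} :
    HasDerivAt q v t ↔ HasDerivAt (fun s => (q s).ofLp) v.ofLp t := by
  let e := EuclideanSpace.equiv (Fin (m + 1)) ℝ
  constructor
  · intro h
    exact e.hasFDerivAt.comp_hasDerivAt t h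
  · intro h
    exact e.symm.hasFDerivAt.comp_hasDerivAt t h

/-! ### Constancy and uniqueness on an interval -/

theorem eq_of_hasDerivAt_zero {I : Set ℝ} (hIo : IsOpen I) (hIc : I.OrdConnected) {f : ℝ → ℝ}
    (hf : ∀ t ∈ I, HasDerivAt f 0 t) {s t : ℝ} (hs : s ∈ I) (ht : t ∈ I) : f s = f t :=
  hIo.is_const_of_deriv_eq_zero hIc.isPreconnected
    (fun x hx => (hf x hx).differentiableAt.differentiableWithinAt)
    (fun x hx => (hf x hx).deriv) hs ht

theorem matrix_eq_of_hasDerivAt_zero {I : Set ℝ} (hIo : IsOpen I) (hIc : I.OrdConnected) {k : ℕ}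
    {F : ℝ → Mat k} (hF : ∀ t ∈ I, HasDerivAt F 0 t) {s t : ℝ} (hs : s ∈ I) (ht : t ∈ I) :
    F s = F t := by
  ext i j
  exact eq_of_hasDerivAt_zero hIo hIc
    (fun x hx => hasDerivAt_matrix.1 (hF x hx) i j) hs ht

theorem vector_eq_of_hasDerivAt_zero {I : Set ℝ} (hIo : IsOpen I) (hIc : I.OrdConnected) {k : ℕ}
    {x : ℝ → Fin k → ℝ} (hx : ∀ t ∈ I, HasDerivAt x 0 t) {s t : ℝ} (hs : s ∈ I) (ht : t ∈ I) :
    x s = x t := by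
  ext i
  exact eq_of_hasDerivAt_zero hIo hIc (fun y hy => hasDerivAt_pi.1 (hx y hy) i) hs ht

theorem eq_zero_of_trace_transpose_mul_self {k : ℕ} {Z : Mat k} (h : (Zᵀ * Z).trace = 0) :
    Z = 0 := by
  rw [← Matrix.conjTranspose_eq_transpose_of_trivial] at h
  exact Matrix.trace_conjTranspose_mul_self_eq_zero_iff.1 h

/-- Skew solutions of `Y' = [B, Y]` are determined by one value, since their norm is constant. -/
theorem eq_of_hasDerivAt_commutator {I : Set ℝ} (hIo : IsOpen I) (hIc : I.OrdConnected) {k : ℕ}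
    {Y Z B : ℝ → Mat k} (hYt : ∀ t ∈ I, (Y t)ᵀ = -Y t) (hZt : ∀ t ∈ I, (Z t)ᵀ = -Z t)
    (hY : ∀ t ∈ I, HasDerivAt Y (B t * Y t - Y t * B t) t)
    (hZ : ∀ t ∈ I, HasDerivAt Z (B t * Z t - Z t * B t) t) {s t : ℝ} (hs : s ∈ I) (ht : t ∈ I)
    (h : Y s = Z s) : Y t = Z t := by
  have hd : ∀ t ∈ I, HasDerivAt (fun x => ((Y x - Z x)ᵀ * (Y x - Z x)).trace) 0 t := by
    intro t ht
    have h1 := hasDerivAt_matrix_sub (hY t ht) (hZ t ht)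
    have h2 := hasDerivAt_matrix_mul (hasDerivAt_matrix_transpose h1) h1
    have h3 : HasDerivAt (fun x => ((Y x - Z x)ᵀ * (Y x - Z x)).trace) _ t :=
      HasDerivAt.fun_sum fun i _ => hasDerivAt_matrix.1 h2 i i
    convert! h3 using 1
    change (0 : ℝ) = Matrix.trace _
    have h4 : B t * Y t - Y t * B t - (B t * Z t - Z t * B t)
        = B t * (Y t - Z t) - (Y t - Z t) * B t := by noncomm_ring
    have h5 : (Y t - Z t)ᵀ = -(Y t - Z t) := by
      rw [Matrix.transpose_sub, hYt t ht, hZt t ht]; abel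
    rw [h4]
    -- The difference `D` solves the same linear equation, and the derivative of `tr (Dᵀ D)` cancels
    -- by cyclicity of the trace. Only skewness of `D` enters; `B` may be arbitrary.
    generalize Y t - Z t = D at *
    rw [Matrix.trace_add, Matrix.transpose_sub, Matrix.transpose_mul, Matrix.transpose_mul, h5]
    have e1 : (B t)ᵀ * -D = -((B t)ᵀ * D) := by simp
    have e2 : (D * (B t)ᵀ * D).trace = ((B t)ᵀ * D * D).trace := by
      rw [Matrix.mul_assoc, Matrix.trace_mul_comm]
    have e3 : (D * B t * D).trace = (D * D * B t).trace := by
      rw [Matrix.trace_mul_comm, Matrix.mul_assoc]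
    simp only [Matrix.sub_mul, Matrix.mul_sub, Matrix.neg_mul, Matrix.mul_neg, Matrix.trace_sub,
      Matrix.trace_neg, ← Matrix.mul_assoc]
    rw [e2, e3]
    ring
  have h1 := eq_of_hasDerivAt_zero hIo hIc hd hs ht
  simp only [h, sub_self, Matrix.mul_zero, Matrix.trace_zero] at h1
  exact sub_eq_zero.1 (eq_zero_of_trace_transpose_mul_self h1.symm)

/-! ### The covariant derivative in terms of skew matrices -/

/-- This is the splitting of `so(n)` into `so(n-1)` and its complement `ℝⁿ⁻¹ ∧ e_n`. For `T = theta
f f'` the first part is the connection form, and the second is fixed by the motion of the base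
point. -/
theorem skew_eq_corner_add_wedge {m : ℕ} {T : Mat (m + 1)} (hT : Tᵀ = -T) :
    T = corner (T.submatrix Fin.castSucc Fin.castSucc) + wedge (T *ᵥ eLast m) (eLast m) := by
  have hs : ∀ i j, T i j = -T j i := fun i j => by
    rw [← Matrix.transpose_apply T, hT]; rfl
  have h0 : T (Fin.last m) (Fin.last m) = 0 := by linarith [hs (Fin.last m) (Fin.last m)]
  ext i j
  simp only [Matrix.add_apply, wedge, Matrix.sub_apply, Matrix.vecMulVec_apply, mulVec_eLast]
  refine Fin.lastCases ?_ (fun i => ?_) i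
  · refine Fin.lastCases ?_ (fun j => ?_) j
    · simp [corner_last_left, h0]
    · simp [corner_last_left, eLast, hs (Fin.last m) j.castSucc]
  · refine Fin.lastCases ?_ (fun j => ?_) j
    · simp [corner_last_right, eLast]
    · simp [corner_castSucc, eLast]

/-- A derivative `f'` of a curve of frames: `f⁻¹ f'` is a multiple of `1` plus its skew part. -/
theorem theta_of_hasDerivAt {m : ℕ} {f : ℝ → Frame m} {f' : Mat (m + 1)} {q : ℝ → Vec m}
    {v : Vec m} {t : ℝ} (hf : HasDerivAt (fun s => (f s).mat) f' t)
    (hq : ∀ᶠ s in nhds t, (f s).proj = q s) (hv : HasDerivAt q v t) :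
    ∃ σ : ℝ, (f t).mat⁻¹ * f' = σ • (1 : Mat (m + 1)) + theta (f t).mat f' := by
  have hqv := hasDerivAt_ofLp.1 hv
  have h1 := hasDerivAt_matrix_mul (hasDerivAt_matrix_transpose hf) hf
  have h2 := hasDerivAt_matrix_smul (hasDerivAt_dotProduct hqv hqv)
    (hasDerivAt_matrix_const (1 : Mat (m + 1)) t)
  have h3 : (fun s => (f s).matᵀ * (f s).mat)
      =ᶠ[nhds t] fun s => ((q s).ofLp ⬝ᵥ (q s).ofLp) • (1 : Mat (m + 1)) := by
    filter_upwards [hq] with s hs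
    rw [(f s).transpose_mul, hs, normSq_eq_dotProduct]
  -- Differentiating `fᵀ f = |q|² 1` shows that the symmetric part of `f⁻¹ f'` is scalar.
  have h4 := hasDerivAt_matrix_unique h1 (hasDerivAt_matrix_congr h2 h3)
  rw [smul_zero, add_zero] at h4
  set c := v.ofLp ⬝ᵥ (q t).ofLp + (q t).ofLp ⬝ᵥ v.ofLp
  have hpos := (f t).norm_proj_pos
  have h5 : ((f t).mat⁻¹ * f') + ((f t).mat⁻¹ * f')ᵀ
      = ((‖(f t).proj‖ ^ 2)⁻¹ * c) • (1 : Mat (m + 1)) := by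
    rw [(f t).inv_eq]
    rw [mul_smul, ← h4, Matrix.smul_mul, Matrix.transpose_smul, Matrix.transpose_mul,
      Matrix.transpose_transpose, smul_add]
    exact add_comm _ _
  refine ⟨(1 / 2) * ((‖(f t).proj‖ ^ 2)⁻¹ * c), ?_⟩
  rw [mul_smul, ← h5, theta]
  module

/-- Differentiability follows from `f⁻¹ = |q|⁻² fᵀ`; the value of the derivative then comes from
differentiating `f⁻¹ f = 1`. -/
theorem hasDerivAt_frame_inv {m : ℕ} {f : ℝ → Frame m} {f' : Mat (m + 1)} {q : ℝ → Vec m}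
    {v : Vec m} {t : ℝ} (hf : HasDerivAt (fun s => (f s).mat) f' t)
    (hq : ∀ᶠ s in nhds t, (f s).proj = q s) (hv : HasDerivAt q v t) :
    HasDerivAt (fun s => (f s).mat⁻¹) (-((f t).mat⁻¹ * f' * (f t).mat⁻¹)) t := by
  have hqv := hasDerivAt_ofLp.1 hv
  have hqt := hq.self_of_nhds
  have hpos := (f t).norm_proj_pos
  have h0 : (q t).ofLp ⬝ᵥ (q t).ofLp ≠ 0 := by
    rw [← normSq_eq_dotProduct, ← hqt]; positivity
  have h1 := hasDerivAt_matrix_smul ((hasDerivAt_dotProduct hqv hqv).inv h0)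
    (hasDerivAt_matrix_transpose hf)
  have h2 : (fun s => (f s).mat⁻¹)
      =ᶠ[nhds t] fun s => ((q s).ofLp ⬝ᵥ (q s).ofLp)⁻¹ • (f s).matᵀ := by
    filter_upwards [hq] with s hs
    rw [(f s).inv_eq, hs, normSq_eq_dotProduct]
  have h3 := hasDerivAt_matrix_congr h1 h2
  have h4 := hasDerivAt_matrix_mul h3 hf
  simp only [Frame.inv_mul] at h4
  have h5 := hasDerivAt_matrix_unique h4 (hasDerivAt_matrix_const 1 t)
  have h6 := congrArg (· * (f t).mat⁻¹) (eq_neg_of_add_eq_zero_left h5)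
  simp only [Matrix.mul_assoc, (f t).mul_inv, Matrix.mul_one, Matrix.neg_mul] at h6
  rw [h6] at h3
  rw [Matrix.mul_assoc]
  exact h3

theorem hasDerivAt_corner {m : ℕ} {X : ℝ → Mat m} {X' : Mat m} {t : ℝ} (h : HasDerivAt X X' t) :
    HasDerivAt (fun s => corner (X s)) (corner X') t := by
  rw [hasDerivAt_matrix] at *
  intro i j
  refine Fin.lastCases ?_ (fun i => ?_) i
  · simp only [corner_last_left]; exact hasDerivAt_const _ _
  · refine Fin.lastCases ?_ (fun j => ?_) j
    · simp only [corner_last_right]; exact hasDerivAt_const _ _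
    · simp only [corner_castSucc]; exact h i j

theorem theta_transpose {m : ℕ} (f v : Mat (m + 1)) : (theta f v)ᵀ = -theta f v := by
  simp only [theta, Matrix.transpose_smul, Matrix.transpose_sub, Matrix.transpose_transpose]
  module

/-- A parallel section `φ` over `q` satisfies `Φ' = r⁻² [q' ∧ q, Φ]` for its skew matrix `Φ`. -/
theorem HasCovDerivAt.hasDerivAt_toSkew {m : ℕ} {φ : ℝ → AdBundle m} {ψ : AdBundle m} {t : ℝ}
    (h : HasCovDerivAt φ ψ t) (hψ : ψ.IsZero) {q : ℝ → Vec m} {v : Vec m}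
    (hq : ∀ᶠ s in nhds t, (φ s).proj = q s) (hv : HasDerivAt q v t) :
    HasDerivAt (fun s => (φ s).toSkew)
      (((‖q t‖ ^ 2)⁻¹ • wedge v.ofLp (q t).ofLp) * (φ t).toSkew
        - (φ t).toSkew * ((‖q t‖ ^ 2)⁻¹ • wedge v.ofLp (q t).ofLp)) t := by
  obtain ⟨f, X, f', X', hφ, hf, hX, rfl⟩ := h
  have hX0 := congrArg (Subtype.val) (AdBundle.eq_zero_of_isZero hψ)
  have hfq : ∀ᶠ s in nhds t, (f s).proj = q s := by
    filter_upwards [hq, hφ] with s h1 h2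
    rw [← h1, h2, AdBundle.proj_mk]
  have hqt := hfq.self_of_nhds
  obtain ⟨σ, hσ⟩ := theta_of_hasDerivAt hf hfq hv
  have hE := hasDerivAt_corner hX
  have hmain := hasDerivAt_matrix_mul (hasDerivAt_matrix_mul hf hE)
    (hasDerivAt_frame_inv hf hfq hv)
  have hev : (fun s => (φ s).toSkew)
      =ᶠ[nhds t] fun s => (f s).mat * corner (X s : Mat m) * (f s).mat⁻¹ := by
    filter_upwards [hφ] with s hs
    rw [hs, AdBundle.toSkew_mk]
  have hmain' := hasDerivAt_matrix_congr hmain hev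
  convert! hmain' using 1
  have hφt := hev.self_of_nhds
  simp only at hφt
  rw [hφt]
  have hcol : f' *ᵥ eLast m = v.ofLp := by
    have h1 := hasDerivAt_mulVec hf (hasDerivAt_const t (eLast m))
    have h2 : (fun s => (q s).ofLp) =ᶠ[nhds t] fun s => (f s).mat *ᵥ eLast m := by
      filter_upwards [hfq] with s hs
      rw [(f s).mulVec_eLast, hs]
    have h3 := (h1.congr_of_eventuallyEq h2).unique (hasDerivAt_ofLp.1 hv)
    simpa using h3
  have hf' : f' = (f t).mat * (σ • (1 : Mat (m + 1)) + theta (f t).mat f') := by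
    rw [← hσ, ← Matrix.mul_assoc, (f t).mul_inv, Matrix.one_mul]
  set T := theta (f t).mat f' with hT
  have hTe : (f t).mat *ᵥ (T *ᵥ eLast m) = v.ofLp + (-σ) • (q t).ofLp := by
    have h1 := hcol
    rw [hf', ← Matrix.mulVec_mulVec, Matrix.add_mulVec, Matrix.mulVec_add, Matrix.smul_mulVec,
      Matrix.one_mulVec, Matrix.mulVec_smul, (f t).mulVec_eLast, hqt] at h1
    rw [← h1]
    module
  -- The scaling term `σ q` is invisible here because `q ∧ q = 0`.
  have hW : (f t).mat * wedge (T *ᵥ eLast m) (eLast m) * (f t).mat⁻¹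
      = (‖q t‖ ^ 2)⁻¹ • wedge v.ofLp (q t).ofLp := by
    rw [(f t).conj_wedge, hTe, (f t).mulVec_eLast, hqt, wedge_add_left, wedge_smul_left,
      wedge_self, smul_zero, add_zero]
  rw [← hW]
  have hTd := skew_eq_corner_add_wedge (theta_transpose (f t).mat f')
  rw [← hT] at hTd
  set W := wedge (T *ᵥ eLast m) (eLast m)
  have hA : (connForm (f t).mat f' : Mat m) = T.submatrix Fin.castSucc Fin.castSucc := rfl
  set A := T.submatrix Fin.castSucc Fin.castSucc
  -- Parallelism says `X' = [X, A]`. This cancels the `so(n-1)`-part of `f⁻¹ f'` in the derivative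
  -- of `f diag(X, 0) f⁻¹`, and the scalar `σ` commutes with everything, so only the bracket with
  -- `W` survives.
  have hX' : corner (X' : Mat m) = corner (X t : Mat m) * corner A - corner A * corner (X t) := by
    have h1 : (X' : Mat m) + (A * (X t : Mat m) - (X t : Mat m) * A) = 0 := by
      rw [← hA]; exact hX0
    rw [← corner_mul, ← corner_mul, ← corner_sub, eq_neg_of_add_eq_zero_left h1]
    congr 1
    abel
  have hinv : ∀ M N : Mat (m + 1), (f t).mat * M * (f t).mat⁻¹ * ((f t).mat * N * (f t).mat⁻¹)
      = (f t).mat * (M * N) * (f t).mat⁻¹ := by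
    intro M N
    calc _ = (f t).mat * M * ((f t).mat⁻¹ * (f t).mat) * N * (f t).mat⁻¹ := by
          simp only [Matrix.mul_assoc]
      _ = _ := by rw [(f t).inv_mul, Matrix.mul_one]; simp only [Matrix.mul_assoc]
  rw [hinv, hinv, hX', hσ, hTd, hf', hTd]
  generalize corner (X t : Mat m) = E
  generalize corner A = A
  generalize (f t).mat⁻¹ = G
  generalize (f t).mat = K
  simp only [Matrix.mul_add, Matrix.add_mul, Matrix.mul_sub, Matrix.sub_mul, Matrix.mul_smul,
    Matrix.smul_mul, Matrix.mul_one, Matrix.one_mul, Matrix.mul_neg, Matrix.mul_assoc]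
  abel

/-! ### Exponentials of skew matrices -/

theorem exp_transpose_mul {k : ℕ} {X : Mat k} (hX : Xᵀ = -X) :
    (NormedSpace.exp X)ᵀ * NormedSpace.exp X = 1 := by
  rw [← Matrix.exp_transpose, hX, Matrix.exp_neg]
  exact Matrix.nonsing_inv_mul _ ((Matrix.isUnit_iff_isUnit_det _).1 (Matrix.isUnit_exp X))

theorem smul_skew {k : ℕ} {X : Mat k} (hX : Xᵀ = -X) (s : ℝ) : (s • X)ᵀ = -(s • X) := by
  rw [Matrix.transpose_smul, hX, smul_neg]

/-- The exponential is the square of the invertible matrix `exp(X/2)`. -/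
theorem det_exp_pos {k : ℕ} (X : Mat k) : 0 < (NormedSpace.exp X).det := by
  have h1 : NormedSpace.exp X
      = NormedSpace.exp ((1 / 2 : ℝ) • X) * NormedSpace.exp ((1 / 2 : ℝ) • X) := by
    rw [← Matrix.exp_add_of_commute _ _ (Commute.refl _), ← add_smul]
    norm_num
  have h2 := ((Matrix.isUnit_iff_isUnit_det _).1
    (Matrix.isUnit_exp ((1 / 2 : ℝ) • X))).ne_zero
  rw [h1, Matrix.det_mul]
  exact mul_self_pos.2 h2

theorem hasDerivAt_exp_smul {k : ℕ} (X : Mat k) {u : ℝ → ℝ} {u' t : ℝ} (hu : HasDerivAt u u' t) :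
    HasDerivAt (fun s => NormedSpace.exp (u s • X)) (u' • (NormedSpace.exp (u t • X) * X)) t := by
  have h : HasDerivAt (fun s : ℝ => NormedSpace.exp (s • X)) (NormedSpace.exp (u t • X) * X)
      (u t) := by
    let _ : NormedRing (Mat k) := Matrix.linftyOpNormedRing
    let _ : NormedAlgebra ℝ (Mat k) := Matrix.linftyOpNormedAlgebra
    exact hasDerivAt_exp_smul_const (𝕂 := ℝ) X (u t)
  rw [hasDerivAt_matrix] at *
  intro i j
  exact ((h i j).scomp t hu)

theorem exp_smul_mul_comm {k : ℕ} (X : Mat k) (s : ℝ) :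
    NormedSpace.exp (s • X) * X = X * NormedSpace.exp (s • X) := by
  let _ : NormedRing (Mat k) := Matrix.linftyOpNormedRing
  let _ : NormedAlgebra ℝ (Mat k) := Matrix.linftyOpNormedAlgebra
  exact (((Commute.refl X).smul_left s).exp_left).eq

theorem exp_smul_add {k : ℕ} (X : Mat k) (s t : ℝ) :
    NormedSpace.exp ((s + t) • X) = NormedSpace.exp (s • X) * NormedSpace.exp (t • X) := by
  rw [add_smul]
  exact Matrix.exp_add_of_commute _ _ (((Commute.refl X).smul_left s).smul_right t)

theorem exp_zero_smul {k : ℕ} (X : Mat k) : NormedSpace.exp ((0 : ℝ) • X) = 1 := by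
  rw [zero_smul]
  exact NormedSpace.exp_zero

theorem exp_smul_mul_exp_neg_smul {k : ℕ} (X : Mat k) (s : ℝ) :
    NormedSpace.exp (s • X) * NormedSpace.exp ((-s) • X) = 1 := by
  rw [← exp_smul_add, add_neg_cancel, exp_zero_smul]

theorem exp_smul_mulVec_of_mulVec_eq_zero {k : ℕ} {X : Mat k} {x : Fin k → ℝ} (h : X *ᵥ x = 0)
    (s : ℝ) : NormedSpace.exp (s • X) *ᵥ x = x := by
  have h1 : ∀ t ∈ Set.univ, HasDerivAt (fun s : ℝ => NormedSpace.exp (s • X) *ᵥ x) 0 t := by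
    intro t _
    have h2 := hasDerivAt_mulVec (hasDerivAt_exp_smul X (hasDerivAt_id t)) (hasDerivAt_const t x)
    convert! h2 using 1
    rw [one_smul, ← Matrix.mulVec_mulVec, h]
    simp
  have h3 := vector_eq_of_hasDerivAt_zero isOpen_univ Set.ordConnected_univ h1
    (Set.mem_univ s) (Set.mem_univ 0)
  simpa [exp_zero_smul] using h3

theorem exp_mulVec_dotProduct {k : ℕ} {X : Mat k} (hX : Xᵀ = -X) (x : Fin k → ℝ) :
    (NormedSpace.exp X *ᵥ x) ⬝ᵥ (NormedSpace.exp X *ᵥ x) = x ⬝ᵥ x := by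
  rw [Matrix.dotProduct_mulVec, ← Matrix.mulVec_transpose, Matrix.mulVec_mulVec,
    exp_transpose_mul hX, Matrix.one_mulVec]

/-! ### The infinitesimal generator and explicit horizontal lifts -/

/-- Conjugation by a frame keeps `ξ` skew, so taking the skew part in `theta` changes nothing. -/
theorem connGen_coe {m : ℕ} (f : Frame m) (ξ : so (m + 1)) :
    (connGen f ξ : Mat m)
      = (f.mat⁻¹ * (ξ : Mat (m + 1)) * f.mat).submatrix Fin.castSucc Fin.castSucc := by
  have h1 : (f.mat⁻¹ * (ξ : Mat (m + 1)) * f.mat)ᵀ = -(f.mat⁻¹ * (ξ : Mat (m + 1)) * f.mat) := by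
    rw [f.inv_conj_transpose, so_transpose]; simp
  have h2 : theta f.mat ((ξ : Mat (m + 1)) * f.mat) = f.mat⁻¹ * (ξ : Mat (m + 1)) * f.mat := by
    rw [theta, ← Matrix.mul_assoc, h1]
    module
  rw [← h2]
  rfl

/-- The skew matrix of `[f, A_f(ξ)]` is the part of `ξ` that kills the base point. -/
theorem toSkew_mk_connGen {m : ℕ} (f : Frame m) (ξ : so (m + 1)) :
    (AdBundle.mk f (connGen f ξ)).toSkew = (ξ : Mat (m + 1))
      - (‖f.proj‖ ^ 2)⁻¹ • wedge ((ξ : Mat (m + 1)) *ᵥ f.proj.ofLp) f.proj.ofLp := by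
  have hpos := f.norm_proj_pos
  have hskew := skew_dotProduct_self (so_transpose ξ) f.proj.ofLp
  set z := f.mat⁻¹ *ᵥ ((ξ : Mat (m + 1)) *ᵥ f.proj.ofLp) with hz
  have hW : f.mat * wedge z (eLast m) * f.mat⁻¹
      = (‖f.proj‖ ^ 2)⁻¹ • wedge ((ξ : Mat (m + 1)) *ᵥ f.proj.ofLp) f.proj.ofLp := by
    rw [f.conj_wedge, f.mulVec_eLast, hz, Matrix.mulVec_mulVec, f.mul_inv, Matrix.one_mulVec]
  refine AdBundle.toSkew_mk_eq f _ ?_ ?_ ?_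
  · rw [Matrix.transpose_sub, Matrix.transpose_smul, wedge_transpose, so_transpose]
    module
  · rw [Matrix.sub_mulVec, Matrix.smul_mulVec, wedge_mulVec,
      dotProduct_comm (_ *ᵥ _) f.proj.ofLp, hskew,
      zero_smul, sub_zero, smul_smul, ← normSq_eq_dotProduct, inv_mul_cancel₀ (by positivity),
      one_smul, sub_self]
  -- In frame coordinates the subtracted term is `z ∧ e_n`, whose `so(n-1)`-block is zero.
  · rw [← hW, connGen_coe, Matrix.mul_sub, Matrix.sub_mul, f.inv_conj_conj]
    ext i j
    simp [wedge, Matrix.vecMulVec_apply, eLast]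

/-- The frame `e^a exp(sξ) f exp(-sη)`, where `η` is the image of `A_f(ξ)` in `so(n)`. -/
def Frame.orbit {m : ℕ} (f : Frame m) (ξ : so (m + 1)) (a s : ℝ) : Frame m where
  mat := Real.exp a • (NormedSpace.exp (s • (ξ : Mat (m + 1))) * f.mat
    * NormedSpace.exp ((-s) • corner (connGen f ξ : Mat m)))
  conformal := by
    obtain ⟨r, hr, hf⟩ := f.conformal
    have h1 := exp_transpose_mul (smul_skew (so_transpose ξ) s)
    have hη : (corner (connGen f ξ : Mat m))ᵀ = -corner (connGen f ξ : Mat m) := by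
      rw [← corner_transpose, so_transpose, ← neg_one_smul ℝ, corner_smul, neg_one_smul]
    have h2 := exp_transpose_mul (smul_skew hη (-s))
    refine ⟨Real.exp a * r, by positivity, ?_⟩
    generalize NormedSpace.exp (s • (ξ : Mat (m + 1))) = U at *
    generalize NormedSpace.exp ((-s) • corner (connGen f ξ : Mat m)) = K at *
    calc (Real.exp a • (U * f.mat * K))ᵀ * (Real.exp a • (U * f.mat * K))
        = (Real.exp a ^ 2) • (Kᵀ * (f.matᵀ * (Uᵀ * U) * f.mat) * K) := by
          simp [Matrix.transpose_mul, Matrix.mul_assoc, smul_smul, sq]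
      _ = _ := by
          rw [h1, Matrix.mul_one, hf]
          simp [h2, smul_smul, mul_pow]
  det_pos := by
    rw [Matrix.det_smul, Matrix.det_mul, Matrix.det_mul]
    have h1 := det_exp_pos (s • (ξ : Mat (m + 1)))
    have h2 := det_exp_pos ((-s) • corner (connGen f ξ : Mat m))
    have h3 := f.det_pos
    positivity

theorem Frame.orbit_zero {m : ℕ} (f : Frame m) (ξ : so (m + 1)) : f.orbit ξ 0 0 = f := by
  apply Frame.ext
  simp only [orbit, neg_zero, exp_zero_smul]
  simp

theorem Frame.orbit_proj {m : ℕ} (f : Frame m) (ξ : so (m + 1)) (a s : ℝ) :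
    (f.orbit ξ a s).proj.ofLp
      = Real.exp a • (NormedSpace.exp (s • (ξ : Mat (m + 1))) *ᵥ f.proj.ofLp) := by
  rw [← Frame.mulVec_eLast, orbit, Matrix.smul_mulVec, ← Matrix.mulVec_mulVec,
    exp_smul_mulVec_of_mulVec_eq_zero (corner_mulVec_eLast _), ← Matrix.mulVec_mulVec,
    f.mulVec_eLast]

theorem corner_one_mul_corner {m : ℕ} (X : Mat m) : corner 1 * corner X = corner X := by
  rw [← corner_mul, Matrix.one_mul]

theorem corner_mul_corner_one {m : ℕ} (X : Mat m) : corner X * corner 1 = corner X := by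
  rw [← corner_mul, Matrix.mul_one]

/-- Here `corner 1` is the orthogonal projection onto the complement of `e_n`, so passing to the
block becomes an algebraic operation inside `Mat (m + 1)`. -/
theorem corner_one_conj {m : ℕ} (M : Mat (m + 1)) :
    corner 1 * M * corner 1 = corner (M.submatrix Fin.castSucc Fin.castSucc) := by
  ext i j
  refine Fin.lastCases ?_ (fun i => ?_) i
  · simp [Matrix.mul_apply, corner_last_left]
  · refine Fin.lastCases ?_ (fun j => ?_) j
    · simp [Matrix.mul_apply, corner_last_right]
    · simp [Matrix.mul_apply, Fin.sum_univ_castSucc, corner_castSucc, corner_last_right,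
        corner_last_left, Matrix.one_apply]

/-- `A(ξ)` is constant along `exp(sξ) f exp(-sη)`. -/
theorem Frame.connGen_orbit {m : ℕ} (f : Frame m) (ξ : so (m + 1)) (a s : ℝ) :
    connGen (f.orbit ξ a s) ξ = connGen f ξ := by
  apply Subtype.ext
  apply corner_injective
  have h0 := connGen_coe f ξ
  set η := corner (connGen f ξ : Mat m) with hη
  -- The projection `corner 1` commutes with `η`, hence with its exponentials. Thus the block of
  -- `exp(sη) N exp(-sη)` is the conjugate of the block of `N`; for `N = f⁻¹ ξ f` that block is `η`,
  -- which conjugation by `exp(sη)` fixes.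
  have hcommP : ∀ s : ℝ, corner (1 : Mat m) * NormedSpace.exp (s • η)
      = NormedSpace.exp (s • η) * corner 1 := by
    intro s
    let _ : NormedRing (Mat (m + 1)) := Matrix.linftyOpNormedRing
    let _ : NormedAlgebra ℝ (Mat (m + 1)) := Matrix.linftyOpNormedAlgebra
    have h1 : Commute (corner (1 : Mat m)) η := by
      rw [Commute, SemiconjBy, corner_one_mul_corner, corner_mul_corner_one]
    exact ((h1.smul_right s).exp_right).eq
  have hinv : (f.orbit ξ a s).mat⁻¹
      = Real.exp (-a) • (NormedSpace.exp (s • η) * f.mat⁻¹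
        * NormedSpace.exp ((-s) • (ξ : Mat (m + 1)))) := by
    refine Matrix.inv_eq_right_inv ?_
    rw [orbit, Matrix.smul_mul, Matrix.mul_smul, smul_smul, ← Real.exp_add, add_neg_cancel,
      Real.exp_zero, one_smul]
    have e1 := exp_smul_mul_exp_neg_smul η (-s)
    rw [neg_neg] at e1
    have e2 := exp_smul_mul_exp_neg_smul (ξ : Mat (m + 1)) s
    calc _ = NormedSpace.exp (s • (ξ : Mat (m + 1))) * f.mat
          * (NormedSpace.exp ((-s) • η) * NormedSpace.exp (s • η)) * f.mat⁻¹
          * NormedSpace.exp ((-s) • (ξ : Mat (m + 1))) := by simp only [Matrix.mul_assoc, hη]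
      _ = 1 := by
        rw [e1, Matrix.mul_one, Matrix.mul_assoc _ f.mat, f.mul_inv, Matrix.mul_one, e2]
  have hconj : (f.orbit ξ a s).mat⁻¹ * (ξ : Mat (m + 1)) * (f.orbit ξ a s).mat
      = NormedSpace.exp (s • η) * (f.mat⁻¹ * (ξ : Mat (m + 1)) * f.mat)
        * NormedSpace.exp ((-s) • η) := by
    have e2 := exp_smul_mul_exp_neg_smul (ξ : Mat (m + 1)) (-s)
    rw [neg_neg] at e2
    have e3 := exp_smul_mul_comm (ξ : Mat (m + 1)) (-s)
    rw [hinv, orbit, Matrix.smul_mul, Matrix.smul_mul, Matrix.mul_smul, smul_smul, ← Real.exp_add,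
      neg_add_cancel, Real.exp_zero, one_smul]
    calc _ = NormedSpace.exp (s • η) * f.mat⁻¹
          * (NormedSpace.exp ((-s) • (ξ : Mat (m + 1))) * (ξ : Mat (m + 1)))
          * NormedSpace.exp (s • (ξ : Mat (m + 1))) * f.mat * NormedSpace.exp ((-s) • η) := by
          simp only [Matrix.mul_assoc, hη]
      _ = NormedSpace.exp (s • η) * f.mat⁻¹ * (ξ : Mat (m + 1))
          * (NormedSpace.exp ((-s) • (ξ : Mat (m + 1)))
          * NormedSpace.exp (s • (ξ : Mat (m + 1)))) * f.mat * NormedSpace.exp ((-s) • η) := by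
          rw [e3]; simp only [Matrix.mul_assoc]
      _ = _ := by rw [e2, Matrix.mul_one]; simp only [Matrix.mul_assoc]
  rw [connGen_coe, ← corner_one_conj, hconj]
  generalize hN : f.mat⁻¹ * (ξ : Mat (m + 1)) * f.mat = N at *
  calc _ = (corner (1 : Mat m) * NormedSpace.exp (s • η)) * N
        * (NormedSpace.exp ((-s) • η) * corner 1) := by simp only [Matrix.mul_assoc]
    _ = NormedSpace.exp (s • η) * (corner 1 * N * corner 1) * NormedSpace.exp ((-s) • η) := by
        rw [hcommP s, ← hcommP (-s)]; simp only [Matrix.mul_assoc]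
    _ = NormedSpace.exp (s • η) * η * NormedSpace.exp ((-s) • η) := by
        rw [corner_one_conj, ← h0]
    _ = η := by
        rw [exp_smul_mul_comm, Matrix.mul_assoc, exp_smul_mul_exp_neg_smul, Matrix.mul_one]

theorem Frame.hasDerivAt_orbit {m : ℕ} (f : Frame m) (ξ : so (m + 1)) {a s : ℝ → ℝ}
    {a' s' t : ℝ} (ha : HasDerivAt a a' t) (hs : HasDerivAt s s' t) :
    HasDerivAt (fun x => (f.orbit ξ (a x) (s x)).mat)
      (a' • (f.orbit ξ (a t) (s t)).mat
        + s' • ((ξ : Mat (m + 1)) * (f.orbit ξ (a t) (s t)).mat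
          - (f.orbit ξ (a t) (s t)).mat * corner (connGen f ξ : Mat m))) t := by
  have h1 := hasDerivAt_exp_smul (ξ : Mat (m + 1)) hs
  have h2 := hasDerivAt_exp_smul (corner (connGen f ξ : Mat m)) hs.neg
  have h3 := hasDerivAt_matrix_smul ha.exp (hasDerivAt_matrix_mul
    (hasDerivAt_matrix_mul h1 (hasDerivAt_matrix_const f.mat t)) h2)
  convert! h3 using 1
  simp only [orbit, exp_smul_mul_comm (ξ : Mat (m + 1)), Pi.neg_apply]
  generalize NormedSpace.exp (s t • (ξ : Mat (m + 1))) = U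
  generalize NormedSpace.exp ((-s t) • corner (connGen f ξ : Mat m)) = K
  simp only [Matrix.mul_smul, Matrix.smul_mul, Matrix.mul_assoc, Matrix.mul_zero,
    add_zero]
  module

/-- With `g` the moved frame, `g⁻¹ g' = a' 1 + s' (g⁻¹ ξ g - η)`. By `Frame.connGen_orbit` the block
of `g⁻¹ ξ g` is still `A_f(ξ)`, so the right factor `exp(-sη)` is exactly what makes the curve
horizontal. -/
theorem Frame.connForm_orbit_deriv {m : ℕ} (f : Frame m) (ξ : so (m + 1)) (a s a' s' : ℝ) :
    connForm (f.orbit ξ a s).mat (a' • (f.orbit ξ a s).mat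
        + s' • ((ξ : Mat (m + 1)) * (f.orbit ξ a s).mat
          - (f.orbit ξ a s).mat * corner (connGen f ξ : Mat m))) = 0 := by
  have hc := f.connGen_orbit ξ a s
  set g := f.orbit ξ a s
  rw [← hc]
  have h1 : (corner (connGen g ξ : Mat m))ᵀ = -corner (connGen g ξ : Mat m) := by
    rw [← corner_transpose, so_transpose, ← neg_one_smul ℝ, corner_smul, neg_one_smul]
  have h2 : (g.mat⁻¹ * (ξ : Mat (m + 1)) * g.mat)ᵀ = -(g.mat⁻¹ * (ξ : Mat (m + 1)) * g.mat) := by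
    rw [g.inv_conj_transpose, so_transpose]; simp
  have h3 : theta g.mat (a' • g.mat + s' • ((ξ : Mat (m + 1)) * g.mat
      - g.mat * corner (connGen g ξ : Mat m)))
      = s' • (g.mat⁻¹ * (ξ : Mat (m + 1)) * g.mat - corner (connGen g ξ : Mat m)) := by
    have h4 : g.mat⁻¹ * (a' • g.mat + s' • ((ξ : Mat (m + 1)) * g.mat
        - g.mat * corner (connGen g ξ : Mat m)))
        = a' • (1 : Mat (m + 1))
          + s' • (g.mat⁻¹ * (ξ : Mat (m + 1)) * g.mat - corner (connGen g ξ : Mat m)) := by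
      rw [Matrix.mul_add, Matrix.mul_smul, Matrix.mul_smul, Matrix.mul_sub, g.inv_mul,
        ← Matrix.mul_assoc, ← Matrix.mul_assoc, g.inv_mul, Matrix.one_mul]
    rw [theta, h4, Matrix.transpose_add, Matrix.transpose_smul, Matrix.transpose_smul,
      Matrix.transpose_sub, h1, h2, Matrix.transpose_one]
    module
  apply Subtype.ext
  change (theta g.mat _).submatrix Fin.castSucc Fin.castSucc = 0
  rw [h3]
  have h5 : (s' • (g.mat⁻¹ * (ξ : Mat (m + 1)) * g.mat - corner (connGen g ξ : Mat m))).submatrix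
      Fin.castSucc Fin.castSucc
      = s' • ((g.mat⁻¹ * (ξ : Mat (m + 1)) * g.mat).submatrix Fin.castSucc Fin.castSucc
        - (corner (connGen g ξ : Mat m)).submatrix Fin.castSucc Fin.castSucc) := rfl
  rw [h5, corner_submatrix, ← connGen_coe, sub_self, smul_zero]

/-! ### Rotated curves, their horizontal lifts and the effective potential -/

theorem rotatedCurve_ofLp {m : ℕ} (ξ : so (m + 1)) (w : Vec m) (r u : ℝ) :
    (rotatedCurve ξ w r u).ofLp = r • (NormedSpace.exp (u • (ξ : Mat (m + 1))) *ᵥ w.ofLp) := rfl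

theorem norm_rotatedCurve {m : ℕ} (ξ : so (m + 1)) {w : Vec m} (hw : ‖w‖ = 1) {r : ℝ}
    (hr : 0 < r) (u : ℝ) : ‖rotatedCurve ξ w r u‖ = r := by
  have h1 : ‖rotatedCurve ξ w r u‖ ^ 2 = r ^ 2 := by
    rw [normSq_eq_dotProduct, rotatedCurve_ofLp, smul_dotProduct, dotProduct_smul,
      exp_mulVec_dotProduct (smul_skew (so_transpose ξ) u), ← normSq_eq_dotProduct, hw]
    simp [sq]
  exact (sq_eq_sq₀ (norm_nonneg _) hr.le).1 h1

/-- The explicit horizontal lift of `q = r exp(uξ) w`. -/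
theorem isHorizontalLift_orbit {m : ℕ} {I : Set ℝ} {t₀ : ℝ} (ht₀ : t₀ ∈ I) {ξ : so (m + 1)}
    {w : Vec m} {r u : ℝ → ℝ} (hr : ∀ t ∈ I, 0 < r t)
    (hr' : ∀ t ∈ I, DifferentiableAt ℝ r t) (hu : ∀ t ∈ I, DifferentiableAt ℝ u t)
    {q : ℝ → Vec m} (hq : ∀ t ∈ I, q t = rotatedCurve ξ w (r t) (u t)) {f₀ : Frame m}
    (hf₀ : f₀.proj = q t₀) :
    IsHorizontalLift I q
      (fun t => f₀.orbit ξ (Real.log (r t / r t₀)) (u t - u t₀)) := by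
  intro t ht
  have h0 := hr t₀ ht₀
  have h1 := hr t ht
  refine ⟨?_, ?_⟩
  · have h2 : (f₀.orbit ξ (Real.log (r t / r t₀)) (u t - u t₀)).proj.ofLp = (q t).ofLp := by
      rw [Frame.orbit_proj, hf₀, hq t₀ ht₀, hq t ht, rotatedCurve_ofLp, rotatedCurve_ofLp,
        Real.exp_log (by positivity), Matrix.mulVec_smul, smul_smul, Matrix.mulVec_mulVec,
        ← exp_smul_add, sub_add_cancel, div_mul_cancel₀ _ h0.ne']
    exact congrArg (WithLp.toLp 2) h2
  · have ha := ((hr' t ht).div_const (r t₀)).log (div_pos h1 h0).ne'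
    exact ⟨_, f₀.hasDerivAt_orbit ξ ha.hasDerivAt ((hu t ht).sub_const (u t₀)).hasDerivAt,
      f₀.connForm_orbit_deriv ξ _ _ _ _⟩

theorem hasDerivAt_effectivePotential (μsq : ℝ) {r : ℝ} (hr : r ≠ 0) :
    HasDerivAt (effectivePotential μsq) (1 / r ^ 2 - μsq / r ^ 3) r := by
  have h1 : HasDerivAt (fun x : ℝ => -x⁻¹ + μsq / 2 * (x ^ 2)⁻¹)
      (-(-(r ^ 2)⁻¹) + μsq / 2 * (-(2 * r ^ 1 * 1) / (r ^ 2) ^ 2)) r :=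
    ((hasDerivAt_inv hr).neg).add ((((hasDerivAt_id r).pow 2).inv (pow_ne_zero 2 hr)).const_mul _)
  have h2 : effectivePotential μsq = fun x : ℝ => -x⁻¹ + μsq / 2 * (x ^ 2)⁻¹ := by
    ext x
    simp only [effectivePotential]
    rw [one_div, div_mul_eq_div_div, div_eq_mul_inv (μsq / 2)]
  rw [h2]
  convert! h1 using 1
  field_simp
  ring

/-- `|Φ + v ∧ q|² = |Φ|² + |v|² |q|² - (v · q)²` if `Φ q = 0`. -/
theorem normSq_add_wedge {k : ℕ} {M : Mat k} (hM : Mᵀ = -M) {v q : Fin k → ℝ} (h : M *ᵥ q = 0) :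
    (1 / 2) * ((M + wedge v q)ᵀ * (M + wedge v q)).trace
      = (1 / 2) * (Mᵀ * M).trace + ((v ⬝ᵥ v) * (q ⬝ᵥ q) - (v ⬝ᵥ q) ^ 2) := by
  have h1 := trace_transpose_mul_wedge hM v q
  have h2 := trace_transpose_mul_wedge (wedge_transpose v q) v q
  have h3 : ((wedge v q)ᵀ * M).trace = (Mᵀ * wedge v q).trace := by
    rw [← Matrix.trace_transpose, Matrix.transpose_mul, Matrix.transpose_transpose]
  -- The cross term is a multiple of `v · M q`, so it vanishes: the two summands are orthogonal.
  rw [h, dotProduct_zero] at h1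
  rw [wedge_mulVec, dotProduct_sub, dotProduct_smul, dotProduct_smul, smul_eq_mul,
    smul_eq_mul] at h2
  rw [Matrix.transpose_add, Matrix.add_mul, Matrix.mul_add, Matrix.mul_add, Matrix.trace_add,
    Matrix.trace_add, Matrix.trace_add, h3, h1, h2]
  ring

/-! ### Solutions of the MICZ-Kepler system -/

/-- The conserved quantity `Φ + q' ∧ q` of a solution. -/
theorem IsMICZKeplerSolution.hasDerivAt_momentum {m : ℕ} {I : Set ℝ} (hIo : IsOpen I)
    {q : ℝ → Vec m} {φ : ℝ → AdBundle m} (h : IsMICZKeplerSolution I q φ) {t : ℝ} (ht : t ∈ I) :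
    HasDerivAt (fun s => (φ s).toSkew + wedge (deriv q s).ofLp (q s).ofLp) 0 t := by
  have hev : ∀ᶠ s in nhds t, (φ s).proj = q s :=
    Filter.mem_of_superset (hIo.mem_nhds ht) fun s hs => h.base s hs
  obtain ⟨ψ, hψ, hcov⟩ := h.parallel t ht
  have hv := (h.differentiable t ht).hasDerivAt
  have h1 := hcov.hasDerivAt_toSkew hψ hev hv
  have h2 := hasDerivAt_wedge (hasDerivAt_ofLp.1 (h.newton t ht)) (hasDerivAt_ofLp.1 hv)
  have h3 := hasDerivAt_matrix_add h1 h2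
  convert! h3 using 1
  have h0 := (φ t).toSkew_mulVec_proj
  have hT := (φ t).toSkew_transpose
  rw [AdBundle.dotCurvature_eq]
  rw [h.base t ht] at h0 ⊢
  generalize (φ t).toSkew = M at *
  have h0' : (q t).ofLp ᵥ* M = 0 := by
    rw [← Matrix.mulVec_transpose, hT, Matrix.neg_mulVec, h0, neg_zero]
  have h4 : (deriv q t).ofLp ᵥ* M = -(M *ᵥ (deriv q t).ofLp) := by
    rw [← Matrix.mulVec_transpose, hT, Matrix.neg_mulVec]
  simp only [WithLp.ofLp_add, WithLp.ofLp_neg, WithLp.ofLp_smul]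
  -- Central forces vanish against `q`. Since `M q = 0` and `M` is skew, `[q' ∧ q, M]` is `-(M q') ∧
  -- q`, the negative of the remaining magnetic contribution; both carry the factor `r⁻²`.
  rw [wedge_self, add_zero, wedge_add_left, wedge_add_left, ← neg_smul, wedge_smul_left,
    wedge_smul_left, wedge_self, smul_zero, smul_zero, zero_add, zero_add, wedge_smul_left,
    Matrix.smul_mul, Matrix.mul_smul, ← smul_sub, ← smul_add]
  simp only [wedge, Matrix.sub_mul, Matrix.mul_sub, Matrix.vecMulVec_mul, Matrix.mul_vecMulVec, h0,
    h0', h4, Matrix.vecMulVec_neg, Matrix.vecMulVec_zero, Matrix.zero_vecMulVec]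
  rw [eq_comm, smul_eq_zero]
  right
  abel

theorem exists_hasDerivAt_of_continuousOn {I : Set ℝ} (hIo : IsOpen I) (hIc : I.OrdConnected)
    {t₀ : ℝ} (ht₀ : t₀ ∈ I) {g : ℝ → ℝ} (hg : ContinuousOn g I) :
    ∃ u : ℝ → ℝ, u t₀ = 0 ∧ ∀ t ∈ I, HasDerivAt u (g t) t := by
  refine ⟨fun t => ∫ x in t₀..t, g x, intervalIntegral.integral_same, fun t ht => ?_⟩
  refine intervalIntegral.integral_hasDerivAt_right
    (ContinuousOn.intervalIntegrable (hg.mono (hIc.uIcc_subset ht₀ ht))) ?_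
    (hg.continuousAt (hIo.mem_nhds ht))
  exact hg.stronglyMeasurableAtFilter hIo t ht

theorem hasDerivAt_norm {m : ℕ} {q : ℝ → Vec m} {v : Vec m} {t : ℝ} (hq : HasDerivAt q v t)
    (h0 : 0 < ‖q t‖) :
    HasDerivAt (fun s => ‖q s‖) (((q t).ofLp ⬝ᵥ v.ofLp) / ‖q t‖) t := by
  have h1 := hasDerivAt_dotProduct (hasDerivAt_ofLp.1 hq) (hasDerivAt_ofLp.1 hq)
  have h2 := h1.sqrt (by rw [← normSq_eq_dotProduct]; positivity)
  have h3 : ∀ s, ‖q s‖ = √((q s).ofLp ⬝ᵥ (q s).ofLp) := fun s => by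
    rw [← normSq_eq_dotProduct, Real.sqrt_sq (norm_nonneg _)]
  simp only [h3]
  convert! h2 using 1
  rw [dotProduct_comm v.ofLp]
  rw [h3] at h0
  field_simp
  ring

/-- The norm of a solution satisfies the one-dimensional Kepler problem. -/
theorem IsMICZKeplerSolution.isRadialSolution {m : ℕ} {I : Set ℝ} (hIo : IsOpen I)
    {q : ℝ → Vec m} {φ : ℝ → AdBundle m} (h : IsMICZKeplerSolution I q φ) {ξ : so (m + 1)}
    (hξ : ∀ t ∈ I, (φ t).toSkew + wedge (deriv q t).ofLp (q t).ofLp = (ξ : Mat (m + 1))) :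
    IsRadialSolution I (soNormSq ξ) (fun t => ‖q t‖) := by
  have hpos : ∀ t ∈ I, 0 < ‖q t‖ := fun t ht => by
    rw [← h.base t ht]; exact (φ t).norm_proj_pos
  have hd : ∀ t ∈ I, HasDerivAt (fun s => ‖q s‖)
      (((q t).ofLp ⬝ᵥ (deriv q t).ofLp) / ‖q t‖) t := fun t ht =>
    hasDerivAt_norm (h.differentiable t ht).hasDerivAt (hpos t ht)
  refine ⟨hpos, fun t ht => (hd t ht).differentiableAt, fun t ht => ?_⟩
  have hr := hpos t ht
  have hev : deriv (fun s => ‖q s‖)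
      =ᶠ[nhds t] fun s => ((q s).ofLp ⬝ᵥ (deriv q s).ofLp) / ‖q s‖ :=
    Filter.mem_of_superset (hIo.mem_nhds ht) fun s hs => (hd s hs).deriv
  have h1 := ((hasDerivAt_dotProduct
    (hasDerivAt_ofLp.1 (h.differentiable t ht).hasDerivAt)
    (hasDerivAt_ofLp.1 (h.newton t ht))).div (hd t ht) hr.ne').congr_of_eventuallyEq hev
  convert! h1 using 1
  rw [(hasDerivAt_effectivePotential _ hr.ne').deriv]
  have h0 := (φ t).toSkew_mulVec_proj
  have hT := (φ t).toSkew_transpose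
  rw [h.base t ht] at h0
  -- The orthogonal splitting of `ξ` expresses the centrifugal coefficient through `|φ|²` and the
  -- angular part of the velocity.
  have hμ : soNormSq ξ = (φ t).normSq + (((deriv q t).ofLp ⬝ᵥ (deriv q t).ofLp) * ‖q t‖ ^ 2
      - ((q t).ofLp ⬝ᵥ (deriv q t).ofLp) ^ 2) := by
    rw [soNormSq, soInner, ← hξ t ht, normSq_add_wedge hT h0, AdBundle.normSq_eq,
      normSq_eq_dotProduct, dotProduct_comm (deriv q t).ofLp (q t).ofLp]
  -- The magnetic force has no radial component, because `Φ` is skew and kills `q`.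
  have hqF : (q t).ofLp ⬝ᵥ ((φ t).toSkew *ᵥ (deriv q t).ofLp) = 0 := by
    have := skew_dotProduct hT (q t).ofLp (deriv q t).ofLp
    rw [h0, zero_dotProduct] at this
    linarith
  rw [hμ, AdBundle.dotCurvature_eq, h.base t ht]
  simp only [WithLp.ofLp_add, WithLp.ofLp_neg, WithLp.ofLp_smul, dotProduct_add, dotProduct_neg,
    dotProduct_smul, hqF, smul_eq_mul, ← normSq_eq_dotProduct (q t)]
  field_simp
  ring

/-- The generator is the conserved momentum. Its action on `q` recovers the angular velocity, and
subtracting its part `q' ∧ q` recovers `Φ`. -/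
theorem IsMICZKeplerSolution.exists_generator {m : ℕ} {I : Set ℝ} (hIo : IsOpen I)
    (hIc : I.OrdConnected) {t₀ : ℝ} (ht₀ : t₀ ∈ I) {q : ℝ → Vec m} {φ : ℝ → AdBundle m}
    (h : IsMICZKeplerSolution I q φ) :
    ∃ (ξ : so (m + 1)) (w : Vec m) (r u : ℝ → ℝ), ‖w‖ = 1 ∧ IsRadialSolution I (soNormSq ξ) r ∧
      (∀ t ∈ I, HasDerivAt u (1 / r t ^ 2) t) ∧
      (∀ t ∈ I, q t = rotatedCurve ξ w (r t) (u t)) ∧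
      ∀ f₀ : Frame m, f₀.proj = q t₀ → IsParallelTransport I q t₀ f₀ (connGen f₀ ξ) φ := by
  let ξ : so (m + 1) := ⟨(φ t₀).toSkew + wedge (deriv q t₀).ofLp (q t₀).ofLp, by
    rw [mem_so_iff, Matrix.transpose_add, wedge_transpose, AdBundle.toSkew_transpose]
    abel⟩
  have hξ : ∀ t ∈ I, (φ t).toSkew + wedge (deriv q t).ofLp (q t).ofLp = (ξ : Mat (m + 1)) :=
    fun t ht => matrix_eq_of_hasDerivAt_zero hIo hIc
      (fun s hs => h.hasDerivAt_momentum hIo hs) ht ht₀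
  have hrad := h.isRadialSolution hIo hξ
  -- Since `Φ q = 0`, only `q' ∧ q` acts on `q`. After division by `r³` the right side is the
  -- derivative of `q/r`, so this is the rotation equation for the direction of `q`.
  have hξq : ∀ t ∈ I, (ξ : Mat (m + 1)) *ᵥ (q t).ofLp
      = ‖q t‖ ^ 2 • (deriv q t).ofLp - ((q t).ofLp ⬝ᵥ (deriv q t).ofLp) • (q t).ofLp := by
    intro t ht
    have h0 := (φ t).toSkew_mulVec_proj
    rw [h.base t ht] at h0
    rw [← hξ t ht, Matrix.add_mulVec, h0, zero_add, wedge_mulVec, normSq_eq_dotProduct,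
      dotProduct_comm (deriv q t).ofLp]
  clear_value ξ
  have hcont : ContinuousOn (fun t => 1 / ‖q t‖ ^ 2) I := by
    intro t ht
    have hp : 0 < ‖q t‖ := hrad.pos t ht
    exact (continuousAt_const.div ((hrad.differentiable t ht).continuousAt.pow 2)
      (pow_pos hp 2).ne').continuousWithinAt
  -- The normalization `u(t₀) = 0` lets `w` be the initial direction `q(t₀)/r(t₀)`.
  obtain ⟨u, hu0, hu⟩ := exists_hasDerivAt_of_continuousOn hIo hIc ht₀ hcont
  have hp0 : 0 < ‖q t₀‖ := hrad.pos t₀ ht₀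
  have hrot : ∀ t ∈ I, q t = rotatedCurve ξ (‖q t₀‖⁻¹ • q t₀) ‖q t‖ (u t) := by
    -- Undoing the rotation by `exp(-uξ)` should leave the direction `q/r` fixed.
    have hconst : ∀ t ∈ I, HasDerivAt (fun s => NormedSpace.exp ((-u s) • (ξ : Mat (m + 1)))
        *ᵥ (‖q s‖⁻¹ • (q s).ofLp)) 0 t := by
      intro t ht
      have hp : 0 < ‖q t‖ := hrad.pos t ht
      have hv := (h.differentiable t ht).hasDerivAt
      have h1 := hasDerivAt_mulVec (hasDerivAt_exp_smul (ξ : Mat (m + 1)) (hu t ht).neg)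
        (((hasDerivAt_norm hv hp).inv hp.ne').smul (hasDerivAt_ofLp.1 hv))
      convert! h1 using 1
      rw [eq_comm, Matrix.smul_mulVec, ← Matrix.mulVec_mulVec, ← Matrix.mulVec_smul,
        Pi.neg_apply, ← Matrix.mulVec_add]
      have h2 : -(1 / ‖q t‖ ^ 2) • ((ξ : Mat (m + 1)) *ᵥ (‖q t‖⁻¹ • (q t).ofLp))
          + (‖q t‖⁻¹ • (deriv q t).ofLp
          + (-(((q t).ofLp ⬝ᵥ (deriv q t).ofLp) / ‖q t‖) / ‖q t‖ ^ 2) • (q t).ofLp) = 0 := by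
        rw [Matrix.mulVec_smul, hξq t ht]
        ext i
        simp only [Pi.add_apply, Pi.smul_apply, Pi.sub_apply, smul_eq_mul, Pi.zero_apply]
        field_simp
        ring
      refine Eq.trans (congrArg _ h2) (Matrix.mulVec_zero _)
    intro t ht
    have hp : 0 < ‖q t‖ := hrad.pos t ht
    have h1 := vector_eq_of_hasDerivAt_zero hIo hIc hconst ht ht₀
    simp only [hu0, neg_zero, exp_zero_smul, Matrix.one_mulVec] at h1
    have h2 : (q t).ofLp = (rotatedCurve ξ (‖q t₀‖⁻¹ • q t₀) ‖q t‖ (u t)).ofLp := by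
      rw [rotatedCurve_ofLp, WithLp.ofLp_smul, ← h1, Matrix.mulVec_mulVec,
        exp_smul_mul_exp_neg_smul, Matrix.one_mulVec, smul_smul, mul_inv_cancel₀ hp.ne', one_smul]
    exact congrArg (WithLp.toLp 2) h2
  refine ⟨ξ, ‖q t₀‖⁻¹ • q t₀, fun t => ‖q t‖, u, ?_, hrad, hu, hrot, fun f₀ hf₀ => ?_⟩
  · rw [norm_smul, norm_inv, norm_norm, inv_mul_cancel₀ hp0.ne']
  · have hlift := isHorizontalLift_orbit ht₀ hrad.pos hrad.differentiable
      (fun t ht => (hu t ht).differentiableAt) hrot hf₀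
    refine ⟨_, hlift, ?_, fun t ht => ?_⟩
    · simp only [div_self hp0.ne', Real.log_one, sub_self, Frame.orbit_zero]
    · have hp : 0 < ‖q t‖ := hrad.pos t ht
      refine AdBundle.ext_toSkew ?_ ?_
      · rw [AdBundle.proj_mk, (hlift t ht).1, h.base t ht]
      -- The constant `A_{f₀}(ξ)` is replaced by `A_f(ξ)` at the current frame, whose skew matrix is
      -- `ξ - r⁻² (ξ q) ∧ q = ξ - q' ∧ q`, that is, `Φ`.
      · rw [← Frame.connGen_orbit f₀ ξ (Real.log (‖q t‖ / ‖q t₀‖)) (u t - u t₀),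
          toSkew_mk_connGen, (hlift t ht).1, hξq t ht, sub_eq_add_neg (_ • _), ← neg_smul,
          wedge_add_left, wedge_smul_left, wedge_smul_left, wedge_self, smul_zero, add_zero,
          smul_smul, inv_mul_cancel₀ (by positivity), one_smul, ← hξ t ht, add_sub_cancel_right]

/-! ### Uniqueness of parallel transport and the converse -/

theorem IsParallelTransport.hasCovDerivAt {m : ℕ} {I : Set ℝ} (hIo : IsOpen I) {q : ℝ → Vec m}
    {t₀ : ℝ} {f₀ : Frame m} {X : so m} {φ : ℝ → AdBundle m}
    (h : IsParallelTransport I q t₀ f₀ X φ) {t : ℝ} (ht : t ∈ I) :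
    ∃ ψ : AdBundle m, ψ.IsZero ∧ HasCovDerivAt φ ψ t := by
  obtain ⟨f, hf, -, hφ⟩ := h
  obtain ⟨-, f', hf', hA⟩ := hf t ht
  refine ⟨AdBundle.mk (f t) 0, ⟨f t, rfl⟩, f, fun _ => X, f', 0,
    Filter.mem_of_superset (hIo.mem_nhds ht) fun s hs => hφ s hs, hf',
    hasDerivAt_matrix_const _ t, ?_⟩
  rw [hA, zero_lie, add_zero]

theorem IsParallelTransport.proj_eq {m : ℕ} {I : Set ℝ} {q : ℝ → Vec m}
    {t₀ : ℝ} {f₀ : Frame m} {X : so m} {φ : ℝ → AdBundle m}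
    (h : IsParallelTransport I q t₀ f₀ X φ) {t : ℝ} (ht : t ∈ I) : (φ t).proj = q t := by
  obtain ⟨f, hf, -, hφ⟩ := h
  rw [hφ t ht, AdBundle.proj_mk, (hf t ht).1]

/-- The converse must treat every `φ` arising from some horizontal lift, while only the explicit
lift can be computed. Both skew matrices solve the same commutator equation with the same initial
value. -/
theorem IsParallelTransport.toSkew_eq {m : ℕ} {I : Set ℝ} (hIo : IsOpen I)
    (hIc : I.OrdConnected) {q : ℝ → Vec m} (hq : ∀ t ∈ I, DifferentiableAt ℝ q t) {t₀ : ℝ}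
    (ht₀ : t₀ ∈ I) {f₀ : Frame m} {X : so m} {φ φ' : ℝ → AdBundle m}
    (h : IsParallelTransport I q t₀ f₀ X φ) (h' : IsParallelTransport I q t₀ f₀ X φ') {t : ℝ}
    (ht : t ∈ I) : (φ t).toSkew = (φ' t).toSkew := by
  have key : ∀ χ : ℝ → AdBundle m, IsParallelTransport I q t₀ f₀ X χ → ∀ t ∈ I,
      HasDerivAt (fun s => (χ s).toSkew)
        (((‖q t‖ ^ 2)⁻¹ • wedge (deriv q t).ofLp (q t).ofLp) * (χ t).toSkew
          - (χ t).toSkew * ((‖q t‖ ^ 2)⁻¹ • wedge (deriv q t).ofLp (q t).ofLp)) t := by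
    intro χ hχ t ht
    obtain ⟨ψ, hψ, hcov⟩ := hχ.hasCovDerivAt hIo ht
    exact hcov.hasDerivAt_toSkew hψ
      (Filter.mem_of_superset (hIo.mem_nhds ht) fun s hs => hχ.proj_eq hs) (hq t ht).hasDerivAt
  refine eq_of_hasDerivAt_commutator hIo hIc (fun s _ => (φ s).toSkew_transpose)
    (fun s _ => (φ' s).toSkew_transpose) (key φ h) (key φ' h') ht₀ ht ?_
  obtain ⟨f, -, hf0, hφ⟩ := h
  obtain ⟨f', -, hf0', hφ'⟩ := h'
  rw [hφ t₀ ht₀, hφ' t₀ ht₀, hf0, hf0']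

/-- Everything is written in terms of the unit vector `W = exp(uξ) w`: `q = r W`, `W' = r⁻² ξ W` and
`Φ = ξ - (ξ W) ∧ W`. The acceleration and the forces then lie in the span of `W` and `ξ² W`, and
their coefficients agree. -/
theorem isMICZKeplerSolution_of_isParallelTransport {m : ℕ} {I : Set ℝ} (hIo : IsOpen I)
    (hIc : I.OrdConnected) {t₀ : ℝ} (ht₀ : t₀ ∈ I) {ξ : so (m + 1)} {w : Vec m} {r u : ℝ → ℝ}
    (hw : ‖w‖ = 1) (hrad : IsRadialSolution I (soNormSq ξ) r)
    (hu : ∀ t ∈ I, HasDerivAt u (1 / r t ^ 2) t) {q : ℝ → Vec m}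
    (hq : ∀ t ∈ I, q t = rotatedCurve ξ w (r t) (u t)) {f₀ : Frame m} (hf₀ : f₀.proj = q t₀) :
    (∃ φ : ℝ → AdBundle m, IsParallelTransport I q t₀ f₀ (connGen f₀ ξ) φ) ∧
      ∀ φ : ℝ → AdBundle m, IsParallelTransport I q t₀ f₀ (connGen f₀ ξ) φ →
        IsMICZKeplerSolution I q φ := by
  have hlift := isHorizontalLift_orbit ht₀ hrad.pos hrad.differentiable
    (fun t ht => (hu t ht).differentiableAt) hq hf₀
  have hpt : IsParallelTransport I q t₀ f₀ (connGen f₀ ξ)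
      (fun t => AdBundle.mk (f₀.orbit ξ (Real.log (r t / r t₀)) (u t - u t₀)) (connGen f₀ ξ)) :=
    ⟨_, hlift, by simp only [div_self (hrad.pos t₀ ht₀).ne', Real.log_one, sub_self,
      Frame.orbit_zero], fun _ _ => rfl⟩
  refine ⟨⟨_, hpt⟩, fun φ hφ => ?_⟩
  let W : ℝ → Fin (m + 1) → ℝ := fun t => NormedSpace.exp (u t • (ξ : Mat (m + 1))) *ᵥ w.ofLp
  have hqW : ∀ t ∈ I, (q t).ofLp = r t • W t := fun t ht => by
    rw [hq t ht, rotatedCurve_ofLp]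
  have hW1 : ∀ t, W t ⬝ᵥ W t = 1 := fun t => by
    rw [exp_mulVec_dotProduct (smul_skew (so_transpose ξ) _), ← normSq_eq_dotProduct, hw, one_pow]
  have hWd : ∀ t ∈ I, HasDerivAt W ((1 / r t ^ 2) • ((ξ : Mat (m + 1)) *ᵥ W t)) t := by
    intro t ht
    have h1 := hasDerivAt_mulVec (hasDerivAt_exp_smul (ξ : Mat (m + 1)) (hu t ht))
      (hasDerivAt_const t w.ofLp)
    convert! h1 using 1
    rw [Matrix.mulVec_zero, add_zero, exp_smul_mul_comm, Matrix.smul_mulVec,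
      ← Matrix.mulVec_mulVec]
  have hnorm : ∀ t ∈ I, ‖q t‖ = r t := fun t ht => by
    rw [hq t ht, norm_rotatedCurve ξ hw (hrad.pos t ht)]
  have hd : ∀ t ∈ I, HasDerivAt q
      (WithLp.toLp 2 (deriv r t • W t + (1 / r t) • ((ξ : Mat (m + 1)) *ᵥ W t))) t := by
    intro t ht
    have hp := hrad.pos t ht
    rw [hasDerivAt_ofLp]
    have h1 := (hrad.differentiable t ht).hasDerivAt.smul (hWd t ht)
    have hev : (fun s => (q s).ofLp) =ᶠ[nhds t] fun s => r s • W s :=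
      Filter.mem_of_superset (hIo.mem_nhds ht) fun s hs => hqW s hs
    convert! h1.congr_of_eventuallyEq hev using 1
    have h2 : r t * (1 / r t ^ 2) = 1 / r t := by field_simp
    rw [smul_smul, h2]
    exact add_comm _ _
  -- The two terms in `r' ξ W`, from rotating `r' W` and from differentiating `1/r`, cancel.
  have hdd : ∀ t ∈ I, HasDerivAt (deriv q)
      (WithLp.toLp 2 (-deriv (effectivePotential (soNormSq ξ)) (r t) • W t
        + (1 / r t ^ 3) • ((ξ : Mat (m + 1)) *ᵥ ((ξ : Mat (m + 1)) *ᵥ W t)))) t := by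
    intro t ht
    have hp := hrad.pos t ht
    rw [hasDerivAt_ofLp]
    have h1 := ((hrad.newton t ht).smul (hWd t ht)).add
      (((hrad.differentiable t ht).hasDerivAt.inv hp.ne').smul
        (hasDerivAt_mulVec (hasDerivAt_matrix_const (ξ : Mat (m + 1)) t) (hWd t ht)))
    have hev : (fun s => (deriv q s).ofLp)
        =ᶠ[nhds t] fun s => deriv r s • W s + (r s)⁻¹ • ((ξ : Mat (m + 1)) *ᵥ W s) :=
      Filter.mem_of_superset (hIo.mem_nhds ht) fun s hs => by
        simp only [Set.mem_ofPred_eq, (hd s hs).deriv, one_div]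
    convert! h1.congr_of_eventuallyEq hev using 1
    rw [Matrix.zero_mulVec, zero_add, Matrix.mulVec_smul, Pi.inv_apply]
    ext i
    simp only [Pi.add_apply, Pi.smul_apply, smul_eq_mul]
    field_simp
    ring
  have hΦ : ∀ t ∈ I, (φ t).toSkew = (ξ : Mat (m + 1)) - wedge ((ξ : Mat (m + 1)) *ᵥ W t) (W t) := by
    intro t ht
    have hp := hrad.pos t ht
    rw [hφ.toSkew_eq hIo hIc (fun s hs => (hd s hs).differentiableAt) ht₀ hpt ht,
      ← Frame.connGen_orbit f₀ ξ (Real.log (r t / r t₀)) (u t - u t₀), toSkew_mk_connGen,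
      (hlift t ht).1, hnorm t ht, hqW t ht, Matrix.mulVec_smul, wedge_smul_left, wedge_smul_right,
      smul_smul, smul_smul, mul_assoc, ← sq, inv_mul_cancel₀ (by positivity), one_smul]
  refine ⟨fun t ht => hφ.proj_eq ht, fun t ht => (hd t ht).differentiableAt, fun t ht => ?_,
    fun t ht => hφ.hasCovDerivAt hIo ht⟩
  have hp := hrad.pos t ht
  have hsk := so_transpose ξ
  have hWξ : W t ⬝ᵥ ((ξ : Mat (m + 1)) *ᵥ W t) = 0 := skew_dotProduct_self hsk _
  have hΦW : (φ t).toSkew *ᵥ W t = 0 := by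
    rw [hΦ t ht, Matrix.sub_mulVec, wedge_mulVec, hW1, dotProduct_comm _ (W t), hWξ]
    simp
  -- The magnetic force acts on `q' = r' W + r⁻¹ ξ W` only through `ξ W`. The extra `|ξ W|² W`
  -- supplies the part of the centrifugal term that `|φ|²` misses, as `|ξ|² = |φ|² + |ξ W|²`.
  have hΦξ : (φ t).toSkew *ᵥ ((ξ : Mat (m + 1)) *ᵥ W t)
      = (ξ : Mat (m + 1)) *ᵥ ((ξ : Mat (m + 1)) *ᵥ W t)
        + (((ξ : Mat (m + 1)) *ᵥ W t) ⬝ᵥ ((ξ : Mat (m + 1)) *ᵥ W t)) • W t := by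
    rw [hΦ t ht, Matrix.sub_mulVec, wedge_mulVec, hWξ]
    module
  have hμ : soNormSq ξ
      = (φ t).normSq + ((ξ : Mat (m + 1)) *ᵥ W t) ⬝ᵥ ((ξ : Mat (m + 1)) *ᵥ W t) := by
    have h1 := normSq_add_wedge (φ t).toSkew_transpose (v := (ξ : Mat (m + 1)) *ᵥ W t) hΦW
    rw [hW1, dotProduct_comm _ (W t), hWξ, ← AdBundle.normSq_eq] at h1
    rw [soNormSq, soInner]
    have h2 : (φ t).toSkew + wedge ((ξ : Mat (m + 1)) *ᵥ W t) (W t) = (ξ : Mat (m + 1)) := by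
      rw [hΦ t ht, sub_add_cancel]
    rw [h2] at h1
    rw [h1]
    ring
  convert! hdd t ht using 1
  rw [AdBundle.dotCurvature_eq, hφ.proj_eq ht, (hd t ht).deriv, hnorm t ht, Matrix.mulVec_add,
    Matrix.mulVec_smul, Matrix.mulVec_smul, hΦW, hΦξ,
    (hasDerivAt_effectivePotential _ hp.ne').deriv, hμ]
  ext i
  have hqi : q t i = r t * W t i := congrFun (hqW t ht) i
  simp only [PiLp.add_apply, PiLp.neg_apply, PiLp.smul_apply, Pi.add_apply, Pi.smul_apply,
    smul_eq_mul, hqi, Pi.zero_apply]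
  field_simp
  ring

end MICZ

end

theorem mainTheorem2 (m : ℕ) (hm : 1 ≤ m) (I : Set ℝ) (hIo : IsOpen I) (hIc : I.OrdConnected)
    (t₀ : ℝ) (ht₀ : t₀ ∈ I) :
    (∀ (q : ℝ → MICZ.Vec m) (φ : ℝ → MICZ.AdBundle m), MICZ.IsMICZKeplerSolution I q φ →
      ∃ (ξ : MICZ.so (m + 1)) (w : MICZ.Vec m) (r u : ℝ → ℝ),
        ‖w‖ = 1 ∧
        MICZ.IsRadialSolution I (MICZ.soNormSq ξ) r ∧
        (∀ t ∈ I, HasDerivAt u (1 / r t ^ 2) t) ∧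
        (∀ t ∈ I, q t = MICZ.rotatedCurve ξ w (r t) (u t)) ∧
        ∀ f₀ : MICZ.Frame m, f₀.proj = q t₀ →
          MICZ.IsParallelTransport I q t₀ f₀ (MICZ.connGen f₀ ξ) φ) ∧
    (∀ (ξ : MICZ.so (m + 1)) (w : MICZ.Vec m) (r u : ℝ → ℝ),
      ‖w‖ = 1 →
      MICZ.IsRadialSolution I (MICZ.soNormSq ξ) r →
      (∀ t ∈ I, HasDerivAt u (1 / r t ^ 2) t) →
      ∀ q : ℝ → MICZ.Vec m, (∀ t ∈ I, q t = MICZ.rotatedCurve ξ w (r t) (u t)) →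
      ∀ f₀ : MICZ.Frame m, f₀.proj = q t₀ →
        (∃ φ : ℝ → MICZ.AdBundle m,
          MICZ.IsParallelTransport I q t₀ f₀ (MICZ.connGen f₀ ξ) φ) ∧
        ∀ φ : ℝ → MICZ.AdBundle m,
          MICZ.IsParallelTransport I q t₀ f₀ (MICZ.connGen f₀ ξ) φ →
            MICZ.IsMICZKeplerSolution I q φ) := by
  exact ⟨fun _ _ h => h.exists_generator hIo hIc ht₀,
    fun _ _ _ _ hw hrad hu _ hq _ hf₀ =>
      MICZ.isMICZKeplerSolution_of_isParallelTransport hIo hIc ht₀ hw hrad hu hq hf₀⟩
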